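/- Let $V=\mathbb{Q}[t_1,t_2,t_3,\dots]$. For a partition $\lambda=(1^{m_1}2^{m_2}\cdots)$ write $m_i(\lambda)=m_i$ for its multiplicities and $\ell(\lambda)$ for its length, and let $P(n)$ be the set of partitions of $n$. Let $S_\lambda(t)\in V$ be the Schur function of $\lambda$ written in the variables $t_j=p_j/j$ ($p_j$ the power sums), that is, $S_\lambda(t)=\det\bigl(h_{\lambda_i-i+j}(t)\bigr)_{1\le i,j\le \ell(\lambda)}$ with $\sum_{n\ge0}h_n(t)z^n=\exp\bigl(\sum_{j\ge1}t_jz^j\bigr)$ and $h_k=0$ for $k<0$. For a strict partition $\lambda$ let $Q_\lambda(t)\in V$ be Schur's $Q$-function of $\lambda$ written in the variables $t_j=2p_j/j$ ($j$ odd), that is, with $\sum_{n\ge0}q_n(t)z^n=\exp\bigl(\sum_{j\ \mathrm{odd}}t_jz^j\bigr)$ and $Q_{(a,b)}=q_aq_b+2\sum_{i=1}^{b}(-1)^iq_{a+i}q_{b-i}$ for $a>b\ge0$, $Q_\lambda(t)$ is the Pfaffian of the alternating matrix with entries $Q_{(\lambda_i,\lambda_j)}$ for $i<j$, where a part $0$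 is appended to $\lambda$ if $\ell(\lambda)$ is odd. For a partition $\lambda$ let $\lambda^r$ be the strict partition whose parts are the $i$ with $m_i(\lambda)$ odd, and let $\lambda^d$ be the partition with $m_i(\lambda^d)=\lfloor m_i(\lambda)/2\rfloor$. For a strict partition $\mu$ let $\tilde\mu$ be the partition into odd parts obtained from $\mu$ by replacing each part $2^pq$ ($q$ odd) by $2^p$ parts equal to $q$; write $\tilde\lambda^r$ for $\widetilde{\lambda^r}$. Put $$W_\mu(t)=Q_{\mu^r}(t)\,S_{\mu^d}(t'),\qquad S_\nu(t')=S_\nu(t)\big|_{t_j\mapsto t_{2j}\ (j\ge 1)} .$$ Let $n\ge 0$. Then the polynomials $W_\mu$ $(\mu\in P(n))$ are linearly independent over $\mathbb{Q}$, there is a (necessarily unique) matrix $A_n=(a_{\lambda\mu})_{\lambda,\mu\in P(n)}$ with $$S_\lambda(t)=\sum_{\mu\in P(n)}a_{\lambda\mu}W_\mu(t)\qquad(\lambda\in P(n)),$$ its entries are integers, and $$|\det A_n|=2^{k_n},\qquad k_n=\sum_{\lambda\in P(n)}\ell(\lambda^d)=\sum_{\lambda\in P(n)}\bigl(\ell(\tilde\lambda^r)-\ell(\lambda^r)\bigr).$$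 -/

import Mathlib

namespace CompoundBasis

noncomputable section

/-- The polynomial ring `ℚ[t_j ; j ≥ 1]`; the variable `t_j` is `MvPolynomial.X j`. (The index set is
`ℕ` for convenience: `X 0` occurs in none of the polynomials below.) -/
abbrev V : Type := MvPolynomial ℕ ℚ

/-- The monomial `∏_j t_j ^ m_j / m_j !` attached to a multiset `(1^{m_1} 2^{m_2} ⋯)`. -/
def divMonomial (ρ : Multiset ℕ) : V :=
  ∏ j ∈ ρ.toFinset,
    (MvPolynomial.C (1 / ((ρ.count j).factorial : ℚ)) * MvPolynomial.X j ^ ρ.count j)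

/-! ### Schur functions -/

/-- The complete homogeneous symmetric function `h_n(t)`, the coefficient of `z ^ n` in
`exp (∑_{j ≥ 1} t_j z ^ j)`; with `t_j = p_j / j` it is the usual `h_n`. -/
def h (n : ℕ) : V := ∑ ρ : n.Partition, divMonomial ρ.parts

/-- `h_k` for an integer index, with `h_k = 0` for `k < 0`. -/
def hInt (k : ℤ) : V := if 0 ≤ k then h k.toNat else 0

/-- The parts in weakly decreasing order. -/
def partsList (s : Multiset ℕ) : List ℕ := s.sort (· ≥ ·)

/-- The Schur function `S_λ(t) = det (h_{λ_i - i + j}(t))_{1 ≤ i, j ≤ ℓ(λ)}` (Jacobi-Trudi) in the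
variables `t_j = p_j / j`; `λ` is given by its multiset of parts. -/
def schurS (lam : Multiset ℕ) : V :=
  Matrix.det (Matrix.of fun i j : Fin (partsList lam).length =>
    hInt (((partsList lam).get i : ℤ) - (i : ℤ) + (j : ℤ)))

/-! ### Schur's `Q`-functions -/

/-- `q_n(t)`, the coefficient of `z ^ n` in `exp (∑_{j odd} t_j z ^ j)`; with `t_j = 2 p_j / j` this
is the coefficient of `z ^ n` in `∏_i (1 + x_i z) / (1 - x_i z)`. -/
def q (n : ℕ) : V := ∑ ρ ∈ Nat.Partition.odds n, divMonomial ρ.parts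

/-- `Q_{(a,b)} = q_a q_b + 2 ∑_{i = 1}^{b} (-1)^i q_{a+i} q_{b-i}`, used for `a > b ≥ 0`. -/
def qTwo (a b : ℕ) : V :=
  q a * q b + 2 * ∑ i ∈ Finset.Icc 1 b, (-1) ^ i * (q (a + i) * q (b - i))

/-- For a list `l = [l_1, …, l_{2m}]`, the Pfaffian of the alternating matrix whose entries above the
diagonal are `f l_i l_j` (`i < j`), through the expansion along the first row. -/
def pfaffian {R : Type} [CommRing R] (f : ℕ → ℕ → R) : List ℕ → R
  | [] => 1
  | a :: l => ∑ i : Fin l.length, (-1) ^ (i : ℕ) * f a (l.get i) * pfaffian f (l.eraseIdx i)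
termination_by l => l.length
decreasing_by
  have := List.length_eraseIdx_le l i
  simp only [List.length_cons]
  omega

/-- Schur's `Q`-function `Q_λ(t)` of a strict partition `λ` (given by its multiset of parts), in the
variables `t_j = 2 p_j / j`: the Pfaffian of `(Q_{(λ_i, λ_j)})`, where a part `0` is appended to `λ`
if its length is odd. -/
def schurQ (lam : Multiset ℕ) : V :=
  pfaffian qTwo (if Even lam.card then partsList lam else partsList lam ++ [0])

/-! ### Maps on partitions -/

/-- `λ^r`: the strict partition whose parts are the `i` with `m_i(λ)` odd. -/
def rPart (lam : Multiset ℕ) : Multiset ℕ :=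
  (lam.toFinset.filter fun i => Odd (lam.count i)).val

/-- `λ^d`: the partition with `m_i(λ^d) = ⌊m_i(λ) / 2⌋`. -/
def dPart (lam : Multiset ℕ) : Multiset ℕ :=
  ∑ i ∈ lam.toFinset, Multiset.replicate (lam.count i / 2) i

/-- The 2-Glaisher map `λ ↦ λ̃`: each part `2^p * q` with `q` odd is replaced by `2^p` parts `q`. -/
def glaisher (lam : Multiset ℕ) : Multiset ℕ :=
  lam.bind fun a => Multiset.replicate (ordProj[2] a) (ordCompl[2] a)

/-! ### The compound basis -/

/-- `W_λ(t) = Q_{λ^r}(t) S_{λ^d}(t')`, where `t'` means the substitution `t_j ↦ t_{2j}`. -/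
def compoundW (lam : Multiset ℕ) : V :=
  schurQ (rPart lam) * MvPolynomial.rename (fun j => 2 * j) (schurS (dPart lam))

end

end CompoundBasis

/-! Write h'_m for h_m(t') and g_m for the coefficient of z^(2m) in h(z)h(-z). Splitting the
exponent into odd and even j gives h(z) = q(z)h'(z²), q(z)q(-z) = 1 and h(z)h(-z) = h'(z²)²; hence
g_m = ∑ h'_i h'_(m-i) = 2h'_m + products of two lower h'.

Over ℤ, the S_λ span the same lattice as all products of h's of degree n, by unitriangularity of
Jacobi-Trudi. Since g_m = ±h_m² + heavier products (larger sum of squared indices), repeated factors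
can be traded for g's, so this lattice is also spanned by the products h_(λ^r) g_(λ^d). Likewise the
W_μ span the same lattice as the products h_(λ^r) h'_(λ^d), because q and h determine each other
integrally modulo h'. Between these two product families the transition is triangular with diagonal
2^ℓ(λ^d) (`rdProd_sub_mem`). So A is unimodular · triangular · unimodular, and its determinant can
be read off up to sign.

The spanning statement `biSpan_le_span_rdProd` serves both lattices, with v = g and v = h'. The
second formula for k_n is a count of multiplicities (`sum_card_dPart`). -/

namespace CompoundBasis

noncomputable section

/-! ### Products over multisets and triangularity -/

section Leading

variable {R : Type*} [CommRing R]

/-- The product `∏ u_{α_i}` over the parts of a multiset. -/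
def monOf (u : ℕ → R) (α : Multiset ℕ) : R := (α.map u).prod

@[simp] lemma monOf_zero (u : ℕ → R) : monOf u 0 = 1 := by simp [monOf]

@[simp] lemma monOf_cons (u : ℕ → R) (a : ℕ) (α : Multiset ℕ) :
    monOf u (a ::ₘ α) = u a * monOf u α := by simp [monOf]

@[simp] lemma monOf_singleton (u : ℕ → R) (a : ℕ) : monOf u {a} = u a := by simp [monOf]

lemma monOf_add (u : ℕ → R) (α β : Multiset ℕ) :
    monOf u (α + β) = monOf u α * monOf u β := by simp [monOf]

lemma monOf_filter_ne_zero {u : ℕ → R} (hu : u 0 = 1) (α : Multiset ℕ) :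
    monOf u (α.filter (· ≠ 0)) = monOf u α := by
  induction α using Multiset.induction_on with
  | empty => simp
  | cons a α ih =>
    by_cases ha : a = 0
    · subst ha; simp [hu, ← ih]
    · rw [Multiset.filter_cons_of_pos (p := fun x => x ≠ 0) _ ha]; simp [← ih]

lemma sum_map_filter_ne_zero {M : Type*} [AddCommMonoid M] {e : ℕ → M} (he : e 0 = 0)
    (α : Multiset ℕ) : ((α.filter (· ≠ 0)).map e).sum = (α.map e).sum := by
  induction α using Multiset.induction_on with
  | empty => simp
  | cons a α ih =>
    by_cases ha : a = 0
    · subst ha; simp [he, ← ih]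
    · rw [Multiset.filter_cons_of_pos (p := fun x => x ≠ 0) _ ha]; simp [← ih]

lemma sum_filter_ne_zero (α : Multiset ℕ) : (α.filter (· ≠ 0)).sum = α.sum := by
  simpa using sum_map_filter_ne_zero (e := fun k : ℕ => k) rfl α

/-- The integral span of the `monOf u ν`, `ν` of size `s`. -/
def monSpan (u : ℕ → R) (s : ℕ) : Submodule ℤ R :=
  Submodule.span ℤ {x | ∃ ν : Multiset ℕ, ν.sum = s ∧ monOf u ν = x}

lemma monOf_mem_monSpan (u : ℕ → R) {s : ℕ} {ν : Multiset ℕ} (h : ν.sum = s) :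
    monOf u ν ∈ monSpan u s := Submodule.subset_span ⟨ν, h, rfl⟩

/-- The integral span of the `monOf u ν`, `ν` of size `s` and of weight above `w`. -/
def above (u : ℕ → R) (e : ℕ → ℤ) (s : ℕ) (w : ℤ) : Submodule ℤ R :=
  Submodule.span ℤ {x | ∃ ν : Multiset ℕ, ν.sum = s ∧ w < (ν.map e).sum ∧ monOf u ν = x}

lemma monOf_mem_above (u : ℕ → R) {e : ℕ → ℤ} {s : ℕ} {w : ℤ} {ν : Multiset ℕ}
    (h : ν.sum = s) (hw : w < (ν.map e).sum) : monOf u ν ∈ above u e s w :=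
  Submodule.subset_span ⟨ν, h, hw, rfl⟩

lemma above_le_monSpan (u : ℕ → R) (e : ℕ → ℤ) (s : ℕ) (w : ℤ) :
    above u e s w ≤ monSpan u s := by
  apply Submodule.span_mono
  rintro x ⟨ν, h, -, rfl⟩
  exact ⟨ν, h, rfl⟩

lemma monOf_mul_above {u : ℕ → R} {e : ℕ → ℤ} {s : ℕ} {w : ℤ} {y : R} (α : Multiset ℕ)
    (hy : y ∈ above u e s w) :
    monOf u α * y ∈ above u e (α.sum + s) ((α.map e).sum + w) := by
  induction hy using Submodule.span_induction with
  | mem x hx =>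
    obtain ⟨ν, h, hw, rfl⟩ := hx
    rw [← monOf_add]
    exact monOf_mem_above u (by simp [h]) (by simpa using hw)
  | zero => simp
  | add x y _ _ hx hy => rw [mul_add]; exact add_mem hx hy
  | smul c x _ hx => rw [mul_smul_comm]; exact Submodule.smul_mem _ _ hx

lemma above_mul_above {u : ℕ → R} {e : ℕ → ℤ} {s t : ℕ} {w z : ℤ} {x y : R}
    (hx : x ∈ above u e s w) (hy : y ∈ above u e t z) :
    x * y ∈ above u e (s + t) (w + z) := by
  induction hx using Submodule.span_induction with
  | mem x hx =>
    obtain ⟨ν, h, hw, rfl⟩ := hx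
    have := monOf_mul_above ν hy
    rw [h] at this
    refine Submodule.span_mono ?_ this
    rintro _ ⟨μ, h1, h2, rfl⟩
    exact ⟨μ, h1, by linarith, rfl⟩
  | zero => simp
  | add x y _ _ hx hy => rw [add_mul]; exact add_mem hx hy
  | smul c x _ hx => rw [smul_mul_assoc]; exact Submodule.smul_mem _ _ hx

/-- `x` is `c ∏ u_{α_i}` plus terms of the same size and larger weight. -/
def HasLeading (u : ℕ → R) (e : ℕ → ℤ) (c : ℤ) (α : Multiset ℕ) (x : R) : Prop :=
  x - c • monOf u α ∈ above u e α.sum (α.map e).sum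

lemma HasLeading.mul {u : ℕ → R} {e : ℕ → ℤ} {c d : ℤ} {α β : Multiset ℕ} {x y : R}
    (hx : HasLeading u e c α x) (hy : HasLeading u e d β y) :
    HasLeading u e (c * d) (α + β) (x * y) := by
  unfold HasLeading at *
  have e1 : x * y - (c * d) • monOf u (α + β) =
      (x - c • monOf u α) * (y - d • monOf u β) +
      (c • (monOf u α * (y - d • monOf u β)) + d • (monOf u β * (x - c • monOf u α))) := by
    rw [monOf_add]
    simp only [zsmul_eq_mul]
    push_cast
    ring
  rw [e1, Multiset.sum_add, Multiset.map_add, Multiset.sum_add]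
  refine add_mem (above_mul_above hx hy) (add_mem ?_ ?_)
  · exact Submodule.smul_mem _ _ (monOf_mul_above α hy)
  · rw [add_comm α.sum, add_comm (Multiset.map e α).sum]
    exact Submodule.smul_mem _ _ (monOf_mul_above β hx)

lemma HasLeading.zsmul {u : ℕ → R} {e : ℕ → ℤ} {c : ℤ} {α : Multiset ℕ} {x : R} (d : ℤ)
    (hx : HasLeading u e c α x) : HasLeading u e (d * c) α (d • x) := by
  unfold HasLeading at *
  rw [mul_smul, ← smul_sub]
  exact Submodule.smul_mem _ _ hx

lemma HasLeading.sum {u : ℕ → R} {e : ℕ → ℤ} {α : Multiset ℕ} {ι : Type*} (s : Finset ι)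
    {c : ι → ℤ} {x : ι → R} (hx : ∀ i ∈ s, HasLeading u e (c i) α (x i)) :
    HasLeading u e (∑ i ∈ s, c i) α (∑ i ∈ s, x i) := by
  unfold HasLeading at *
  rw [Finset.sum_smul, ← Finset.sum_sub_distrib]
  exact Submodule.sum_mem _ hx

lemma hasLeading_monOf (u : ℕ → R) (e : ℕ → ℤ) (α : Multiset ℕ) :
    HasLeading u e 1 α (monOf u α) := by simp [HasLeading]

lemma HasLeading.mem_monSpan {u : ℕ → R} {e : ℕ → ℤ} {c : ℤ} {α : Multiset ℕ} {x : R}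
    (hx : HasLeading u e c α x) : x ∈ monSpan u α.sum := by
  have := add_mem (above_le_monSpan _ _ _ _ hx)
    (Submodule.smul_mem _ c (monOf_mem_monSpan u (rfl : α.sum = α.sum)))
  simpa using this

/-- The square of an index, as an integral weight. -/
def sq (k : ℕ) : ℤ := (k : ℤ) ^ 2

@[simp] lemma sq_zero : sq 0 = 0 := by simp [sq]

lemma sum_sq_le (α : Multiset ℕ) : (α.map sq).sum ≤ (α.sum : ℤ) ^ 2 := by
  induction α using Multiset.induction_on with
  | empty => simp
  | cons a α ih =>
    simp only [Multiset.map_cons, Multiset.sum_cons, sq] at *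
    rw [Nat.cast_add]
    nlinarith [Int.natCast_nonneg a, Int.natCast_nonneg α.sum,
      mul_nonneg (Int.natCast_nonneg a) (Int.natCast_nonneg α.sum)]

/-- Descending induction along the sum of the squares of the parts. -/
lemma monOf_mem_of_above {u : ℕ → R} {B : Submodule ℤ R} {s : ℕ}
    (H : ∀ α : Multiset ℕ, α.sum = s → above u sq s (α.map sq).sum ≤ B → monOf u α ∈ B)
    (α : Multiset ℕ) (hα : α.sum = s) : monOf u α ∈ B := by
  -- By `sum_sq_le` the weight is bounded by s², so the induction on the gap terminates.
  induction hk : ((s : ℤ) ^ 2 - (α.map sq).sum).toNat using Nat.strong_induction_on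
    generalizing α with
  | _ k ih =>
    apply H α hα
    apply Submodule.span_le.2
    rintro _ ⟨ν, h1, h2, rfl⟩
    have h3 := sum_sq_le α
    have h4 := sum_sq_le ν
    rw [hα] at h3
    rw [h1] at h4
    exact ih _ (by omega) ν h1 rfl

/-- `∑ (-1)^i u_i u_{2m-i}`, the coefficients of `u(z) u(-z)`. -/
def altSquare (u : ℕ → R) (m : ℕ) : R :=
  ∑ i ∈ Finset.range (2 * m + 1), (-1) ^ i * (u i * u (2 * m - i))

/-- Among pairs with sum 2m, the balanced one strictly minimises the sum of squares. This allows a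
repeated part m to be exchanged for `altSquare u m` modulo heavier products. -/
lemma altSquare_sub_mem (u : ℕ → R) (m : ℕ) :
    altSquare u m - (-1 : ℤ) ^ m • monOf u {m, m} ∈ above u sq (2 * m) (({m, m} : Multiset ℕ).map sq).sum := by
  have hm : m ∈ Finset.range (2 * m + 1) := by simp; omega
  rw [altSquare, ← Finset.add_sum_erase _ _ hm]
  have : 2 * m - m = m := by omega
  rw [this]
  have e1 : (-1 : R) ^ m * (u m * u m) = (-1 : ℤ) ^ m • monOf u {m, m} := by
    simp [Multiset.insert_eq_cons, zsmul_eq_mul]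
  rw [e1, add_sub_cancel_left]
  apply Submodule.sum_mem
  intro i hi
  simp only [Finset.mem_erase, Finset.mem_range] at hi
  have e2 : (-1 : R) ^ i * (u i * u (2 * m - i)) = (-1 : ℤ) ^ i • monOf u {i, 2 * m - i} := by
    simp [Multiset.insert_eq_cons, zsmul_eq_mul]
  rw [e2]
  apply Submodule.smul_mem
  apply monOf_mem_above
  · simp [Multiset.insert_eq_cons]; omega
  · simp only [Multiset.insert_eq_cons, Multiset.map_cons, Multiset.map_singleton,
      Multiset.sum_cons, Multiset.sum_singleton, sq]
    have h1 : ((2 * m - i : ℕ) : ℤ) = 2 * m - i := by omega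
    rw [h1]
    have h2 : (m : ℤ) - i ≠ 0 := by omega
    have := sq_pos_of_ne_zero h2
    nlinarith

/-- Reduction of `u`-products to products over strict partitions, when the coefficients of
`u(z) u(-z)` act on a graded family `C`. -/
lemma monOf_mul_mem_of_strict {u : ℕ → R} (hu : u 0 = 1) {C : ℕ → Submodule ℤ R}
    (hC : ∀ m j c, c ∈ C j → altSquare u m * c ∈ C (m + j)) {B : Submodule ℤ R} {n : ℕ}
    (hB : ∀ (α : Multiset ℕ) (j : ℕ) (c : R), α.Nodup → 0 ∉ α → c ∈ C j → α.sum + 2 * j = n →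
      monOf u α * c ∈ B)
    (α : Multiset ℕ) (j : ℕ) (c : R) (hc : c ∈ C j) (hn : α.sum + 2 * j = n) :
    monOf u α * c ∈ B := by
  induction hs : α.sum using Nat.strong_induction_on generalizing α j c with
  | _ s ih =>
    let B' : Submodule ℤ R := B.comap (LinearMap.mulRight ℤ c)
    suffices monOf u α ∈ B' by simpa [B'] using this
    refine monOf_mem_of_above (s := s) ?_ α hs
    intro α hα hab
    show monOf u α * c ∈ B
    by_cases hnd : (α.filter (· ≠ 0)).Nodup
    · rw [← monOf_filter_ne_zero hu]
      refine hB _ j c hnd (by simp) hc ?_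
      rw [sum_filter_ne_zero]; omega
    · rw [Multiset.nodup_iff_le] at hnd
      push Not at hnd
      obtain ⟨m, hm⟩ := hnd
      -- A positive m makes γ smaller than α, as the outer induction on the size requires.
      have hm0 : m ≠ 0 := by
        have : m ∈ α.filter (· ≠ 0) := Multiset.mem_of_le hm (by simp)
        simpa using (Multiset.mem_filter.1 this).2
      obtain ⟨γ, hγ⟩ := Multiset.le_iff_exists_add.1 (hm.trans (Multiset.filter_le _ _))
      have hα2 : α = {m, m} + γ := hγ
      have hsum : s = 2 * m + γ.sum := by
        rw [← hα, hα2]; simp [Multiset.insert_eq_cons]; omega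
      have h1 := monOf_mul_above γ (altSquare_sub_mem u m)
      have h2 : above u sq (γ.sum + 2 * m)
          ((γ.map sq).sum + (({m, m} : Multiset ℕ).map sq).sum) ≤ B' := by
        convert hab using 2
        · omega
        · rw [hα2, Multiset.map_add, Multiset.sum_add, add_comm]
      have h3 : monOf u γ * (altSquare u m - (-1 : ℤ) ^ m • monOf u {m, m}) * c ∈ B := h2 h1
      -- The coefficient of u(z)u(-z) is absorbed into the C-factor.
      have h4 := ih γ.sum (by omega) γ (m + j) _ (hC m j c hc) (by omega) rfl
      have e3 : monOf u α * c = (-1 : ℤ) ^ m • (monOf u γ * (altSquare u m * c) -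
          monOf u γ * (altSquare u m - (-1 : ℤ) ^ m • monOf u {m, m}) * c) := by
        rw [hα2, monOf_add]
        simp only [zsmul_eq_mul]
        push_cast
        have : ((-1 : R) ^ m) * (-1) ^ m = 1 := by rw [← mul_pow]; simp
        linear_combination (-(monOf u {m, m} * monOf u γ * c)) * this
      rw [e3]
      exact Submodule.smul_mem _ _ (sub_mem h4 h3)

end Leading

/-! ### The generating functions of `h` and `q` -/

section GeneratingFunctions

open MvPolynomial

lemma divMonomial_eq_prod {ρ : Multiset ℕ} {s : Finset ℕ} (h : ρ.toFinset ⊆ s) :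
    divMonomial ρ = ∏ j ∈ s, (C (1 / ((ρ.count j).factorial : ℚ)) * X j ^ ρ.count j) := by
  refine Finset.prod_subset h fun x _ hx => ?_
  have : ρ.count x = 0 := by simpa using hx
  simp [this]

/-- This is (m+1)/(m+1)! = 1/m!, the effect of removing one part in Newton's recursion. -/
lemma divMonomial_cons (j : ℕ) (ρ : Multiset ℕ) :
    C ((ρ.count j + 1 : ℕ) : ℚ) * divMonomial (j ::ₘ ρ) = X j * divMonomial ρ := by
  have hj : j ∈ (j ::ₘ ρ).toFinset := by simp
  rw [divMonomial_eq_prod (Finset.Subset.refl (j ::ₘ ρ).toFinset),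
    divMonomial_eq_prod (s := (j ::ₘ ρ).toFinset) (by simp), ← Finset.mul_prod_erase _ _ hj,
    ← Finset.mul_prod_erase _ _ hj]
  have h1 : ∀ x ∈ (j ::ₘ ρ).toFinset.erase j,
      (C (1 / (((j ::ₘ ρ).count x).factorial : ℚ)) * X x ^ (j ::ₘ ρ).count x : V) =
        C (1 / ((ρ.count x).factorial : ℚ)) * X x ^ ρ.count x := by
    intro x hx
    rw [Multiset.count_cons_of_ne (Finset.ne_of_mem_erase hx)]
  rw [Finset.prod_congr rfl h1, Multiset.count_cons_self, Nat.factorial_succ]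
  have h2 : (C ((ρ.count j + 1 : ℕ) : ℚ) *
      C (1 / (((ρ.count j + 1) * (ρ.count j).factorial : ℕ) : ℚ)) : V) =
      C (1 / ((ρ.count j).factorial : ℚ)) := by
    rw [← C_mul]
    congr 1
    have := Nat.factorial_ne_zero (ρ.count j)
    push_cast
    field_simp
  rw [← h2]
  ring

lemma sum_parts_toFinset {M : Type*} [AddCommMonoid M] {n : ℕ} (ρ : n.Partition) (F : ℕ → M)
    (hF : ∀ j ∉ ρ.parts, F j = 0) :
    ∑ j ∈ ρ.parts.toFinset, F j = ∑ i ∈ Finset.range n, F (i + 1) := by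
  have h1 : ρ.parts.toFinset ⊆ Finset.Ico 1 (n + 1) := by
    intro j hj
    have hj : j ∈ ρ.parts := by simpa using hj
    have h2 := ρ.parts_pos hj
    have h3 := ρ.le_of_mem_parts hj
    simp; omega
  rw [Finset.sum_subset h1 (fun j _ hj => hF j (by simpa using hj)),
    Finset.sum_Ico_eq_sum_range]
  simp [add_comm]

lemma h_zero : h 0 = 1 := by
  simp [h, divMonomial]

/-- Newton's recursion for the `h_n`. -/
lemma succ_mul_h (n : ℕ) :
    ((n + 1 : ℕ) : V) * h (n + 1) =
      ∑ i ∈ Finset.range (n + 1), ((i + 1 : ℕ) : V) * X (i + 1) * h (n - i) := by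
  -- The factor n + 1 is distributed over each partition as the sum of part size times multiplicity.
  have hL : ((n + 1 : ℕ) : V) * h (n + 1) = ∑ i ∈ Finset.range (n + 1),
      ∑ ρ : (n + 1).Partition, ((i + 1 : ℕ) : V) * (((ρ.parts.count (i + 1) : ℕ) : V) *
        divMonomial ρ.parts) := by
    rw [h, Finset.mul_sum, Finset.sum_comm]
    refine Finset.sum_congr rfl fun ρ _ => ?_
    simp only [← mul_assoc]
    rw [← Finset.sum_mul]
    congr 1
    conv_lhs => rw [← ρ.parts_sum]
    rw [Finset.sum_multiset_count, Nat.cast_sum, sum_parts_toFinset]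
    · refine Finset.sum_congr rfl fun i _ => ?_
      rw [smul_eq_mul, Nat.cast_mul, mul_comm]
    · intro j hj
      simp [Multiset.count_eq_zero_of_notMem hj]
  rw [hL]
  refine Finset.sum_congr rfl fun i hi => ?_
  have hi' : i + 1 ≤ n + 1 := by simpa using hi
  let E := Nat.Partition.partitionWithPartEquiv (n := n + 1) (a := i + 1) (by omega) hi'
  have hn : n - i = n + 1 - (i + 1) := by omega
  rw [hn, h, mul_assoc, Finset.mul_sum, ← Finset.mul_sum]
  congr 1
  rw [← E.sum_comp, ← Finset.sum_subset (Finset.filter_subset (fun ρ : (n + 1).Partition =>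
    i + 1 ∈ ρ.parts) Finset.univ), Finset.sum_subtype (p := fun ρ => i + 1 ∈ ρ.parts)]
  · refine Finset.sum_congr rfl fun ρ _ => ?_
    obtain ⟨γ, hγ⟩ := Multiset.exists_cons_of_mem ρ.2
    have h1 : (E ρ).parts = γ := by simp [E, hγ]
    rw [h1, hγ, ← divMonomial_cons, Multiset.count_cons_self]
    simp
  · simp
  · intro ρ _ hρ
    have : i + 1 ∉ ρ.parts := by simpa using hρ
    simp [Multiset.count_eq_zero_of_notMem this]

/-- The substitution `t_j ↦ 0` for even `j`. -/
def killEven : V →ₐ[ℚ] V := aeval fun j => if Even j then 0 else X j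

lemma q_eq_killEven (n : ℕ) : q n = killEven (h n) := by
  rw [q, h, map_sum, Nat.Partition.odds, Nat.Partition.restricted, Finset.sum_filter]
  refine Finset.sum_congr rfl fun ρ _ => ?_
  rw [divMonomial, map_prod]
  split_ifs with hρ
  · refine Finset.prod_congr rfl fun j hj => ?_
    have := hρ j (by simpa using hj)
    simp [killEven, this]
  · push Not at hρ
    obtain ⟨j, hj, he⟩ := hρ
    symm
    apply Finset.prod_eq_zero (i := j) (by simpa using hj)
    have : ρ.parts.count j ≠ 0 := by simpa using hj
    simp [killEven, he, this]

/-- A sequence satisfying Newton's recursion for the constants `c`. -/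
def IsNewton (c u : ℕ → V) : Prop :=
  u 0 = 1 ∧ ∀ n, ((n + 1 : ℕ) : V) * u (n + 1) =
      ∑ i ∈ Finset.range (n + 1), ((i + 1 : ℕ) : V) * c (i + 1) * u (n - i)

lemma IsNewton.map {c u : ℕ → V} (hu : IsNewton c u) (φ : V →ₐ[ℚ] V) :
    IsNewton (fun j => φ (c j)) (fun j => φ (u j)) := by
  refine ⟨by simp [hu.1], fun n => ?_⟩
  have := congrArg φ (hu.2 n)
  simpa using this

/-- The factor n + 1 is cancellable, so the recursion determines u. Identities between generating
functions thus reduce to comparing their exponents. -/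
lemma IsNewton.unique {c u v : ℕ → V} (hu : IsNewton c u) (hv : IsNewton c v) : u = v := by
  funext n
  induction n using Nat.strong_induction_on with
  | _ n ih =>
    rcases n with _ | n
    · rw [hu.1, hv.1]
    · have h0 : ((n + 1 : ℕ) : V) ≠ 0 := by exact_mod_cast Nat.succ_ne_zero n
      apply mul_left_cancel₀ h0
      rw [hu.2, hv.2]
      exact Finset.sum_congr rfl fun i _ => by rw [ih (n - i) (by omega)]

/-- The recursion is u' = c'u read coefficientwise, a form of u = exp(c) that avoids power series
exponentials. -/
lemma isNewton_iff {c u : ℕ → V} : IsNewton c u ↔ u 0 = 1 ∧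
    PowerSeries.derivative V (PowerSeries.mk u) =
      PowerSeries.derivative V (PowerSeries.mk c) * PowerSeries.mk u := by
  unfold IsNewton
  refine and_congr_right fun _ => ?_
  rw [PowerSeries.ext_iff]
  refine forall_congr' fun n => ?_
  rw [PowerSeries.coeff_mul, Finset.Nat.sum_antidiagonal_eq_sum_range_succ_mk]
  simp only [PowerSeries.coeff_derivative, PowerSeries.coeff_mk]
  push_cast
  simp only [mul_comm]

/-- The Cauchy product of two sequences. -/
def cauchy (u v : ℕ → V) (n : ℕ) : V := ∑ i ∈ Finset.range (n + 1), u i * v (n - i)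

lemma mk_cauchy (u v : ℕ → V) :
    PowerSeries.mk (cauchy u v) = PowerSeries.mk u * PowerSeries.mk v := by
  ext1 n
  rw [PowerSeries.coeff_mul, Finset.Nat.sum_antidiagonal_eq_sum_range_succ_mk]
  simp [cauchy]

lemma IsNewton.cauchy {c d u v : ℕ → V} (hu : IsNewton c u) (hv : IsNewton d v) :
    IsNewton (c + d) (cauchy u v) := by
  rw [isNewton_iff] at *
  refine ⟨by simp [CompoundBasis.cauchy, hu.1, hv.1], ?_⟩
  have : PowerSeries.mk (c + d) = PowerSeries.mk c + PowerSeries.mk d := by ext1; simp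
  rw [mk_cauchy, this, map_add, Derivation.leibniz, hu.2, hv.2]
  simp only [smul_eq_mul]
  ring

lemma IsNewton.neg {c u : ℕ → V} (hu : IsNewton c u) :
    IsNewton (fun j => (-1) ^ j * c j) (fun j => (-1) ^ j * u j) := by
  refine ⟨by simp [hu.1], fun n => ?_⟩
  have := congrArg (fun x => (-1) ^ (n + 1) * x) (hu.2 n)
  rw [mul_left_comm, this, Finset.mul_sum]
  refine Finset.sum_congr rfl fun i hi => ?_
  have hi : i ≤ n := by simpa [Nat.lt_succ_iff] using hi
  have : n + 1 = (i + 1) + (n - i) := by omega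
  rw [this, pow_add]
  ring

lemma isNewton_h : IsNewton X h := ⟨h_zero, succ_mul_h⟩

lemma isNewton_zero : IsNewton 0 (fun n => if n = 0 then 1 else 0) := by
  refine ⟨by simp, fun n => by simp⟩

lemma isNewton_q : IsNewton (fun j => if Even j then 0 else X j) q := by
  have := isNewton_h.map killEven
  simp only [← q_eq_killEven] at this
  simpa [killEven] using this

/-- `h_n(t')`. -/
def hTwo (n : ℕ) : V := rename (fun j => 2 * j) (h n)

lemma isNewton_hTwo : IsNewton (fun j => X (2 * j)) hTwo := by
  have := isNewton_h.map (rename (fun j => 2 * j))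
  simp only [rename_X] at this
  exact this

lemma sum_range_two_mul {M : Type*} [AddCommMonoid M] (f : ℕ → M) (k : ℕ) :
    ∑ i ∈ Finset.range (2 * k), f i = ∑ i ∈ Finset.range k, (f (2 * i) + f (2 * i + 1)) := by
  induction k with
  | zero => simp
  | succ k ih =>
    rw [show 2 * (k + 1) = 2 * k + 1 + 1 by ring, Finset.sum_range_succ, Finset.sum_range_succ,
      Finset.sum_range_succ, ih, add_assoc]

/-- The coefficients of `u(z²)`. -/
def double (u : ℕ → V) (j : ℕ) : V := if Even j then u (j / 2) else 0

@[simp] lemma double_two_mul (u : ℕ → V) (j : ℕ) : double u (2 * j) = u j := by simp [double]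

@[simp] lemma double_two_mul_add_one (u : ℕ → V) (j : ℕ) : double u (2 * j + 1) = 0 := by
  simp [double]

lemma isNewton_double {c u : ℕ → V} (hu : IsNewton c u) :
    IsNewton (double c) (double u) := by
  refine ⟨by simp [double, hu.1], fun n => ?_⟩
  rcases Nat.even_or_odd' n with ⟨m, rfl | rfl⟩
  · rw [double_two_mul_add_one, Finset.sum_range_succ, sum_range_two_mul, Finset.sum_eq_zero]
    · simp
    · intro i hi
      have hi : i < m := by simpa using hi
      rw [show 2 * m - (2 * i + 1) = 2 * (m - i - 1) + 1 by omega]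
      simp
  · have := congrArg (fun x => (2 : V) * x) (hu.2 m)
    simp only [Finset.mul_sum] at this
    rw [show 2 * m + 1 + 1 = 2 * (m + 1) by ring, sum_range_two_mul, double_two_mul,
      Nat.cast_mul, mul_assoc, Nat.cast_ofNat, this]
    refine Finset.sum_congr rfl fun i hi => ?_
    have hi : i ≤ m := by simpa [Nat.lt_succ_iff] using hi
    rw [show 2 * i + 1 + 1 = 2 * (i + 1) by ring,
      show 2 * m + 1 - (2 * i + 1) = 2 * (m - i) by omega]
    simp only [double_two_mul_add_one, double_two_mul]
    push_cast
    ring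

lemma h_eq_cauchy : h = cauchy q (double hTwo) := by
  refine isNewton_h.unique ?_
  convert isNewton_q.cauchy (isNewton_double isNewton_hTwo) using 1
  funext j
  rcases Nat.even_or_odd' j with ⟨m, rfl | rfl⟩ <;> simp

/-- The expansion of `h(z) = q(z) h'(z²)`. -/
lemma h_eq_sum (n : ℕ) :
    h n = ∑ i ∈ Finset.range (n / 2 + 1), q (n - 2 * i) * hTwo i := by
  have h1 : h n = ∑ i ∈ Finset.range (n + 1), double hTwo i * q (n - i) := by
    conv_lhs => rw [h_eq_cauchy, cauchy, ← Finset.sum_range_reflect]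
    refine Finset.sum_congr rfl fun i hi => ?_
    have hi : i ≤ n := by simpa [Nat.lt_succ_iff] using hi
    rw [mul_comm, show n + 1 - 1 - i = n - i by omega, show n - (n - i) = i by omega]
  rw [h1]
  rcases Nat.even_or_odd' n with ⟨m, rfl | rfl⟩
  · rw [Finset.sum_range_succ, sum_range_two_mul, show 2 * m / 2 = m by omega,
      Finset.sum_range_succ]
    simp only [double_two_mul, double_two_mul_add_one, zero_mul, add_zero, mul_comm (hTwo _)]
  · rw [show 2 * m + 1 + 1 = 2 * (m + 1) by ring, sum_range_two_mul,
      show (2 * m + 1) / 2 = m by omega]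
    simp only [double_two_mul, double_two_mul_add_one, zero_mul, add_zero, mul_comm (hTwo _)]

lemma altSquare_eq_cauchy (u : ℕ → V) (m : ℕ) :
    altSquare u m = cauchy (fun j => (-1) ^ j * u j) u (2 * m) := by
  simp [altSquare, cauchy, mul_assoc]

/-- The exponent of q is odd in z, so q(z)q(-z) = 1. -/
lemma altSquare_q {m : ℕ} (hm : m ≠ 0) : altSquare q m = 0 := by
  have : cauchy (fun j => (-1) ^ j * q j) q = fun n => if n = 0 then 1 else 0 := by
    refine (isNewton_q.neg.cauchy isNewton_q).unique ?_
    convert isNewton_zero using 1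
    funext j
    by_cases hj : Even j
    · simp [hj]
    · simp [hj, (Nat.not_even_iff_odd.1 hj).neg_one_pow]
  rw [altSquare_eq_cauchy, this]
  simp [hm]

/-- In h(z)h(-z) the odd exponents cancel and the even ones double, leaving h'(z²)². -/
lemma altSquare_h (m : ℕ) : altSquare h m = cauchy hTwo hTwo m := by
  have : cauchy (fun j => (-1) ^ j * h j) h = double (cauchy hTwo hTwo) := by
    refine (isNewton_h.neg.cauchy isNewton_h).unique ?_
    convert isNewton_double (isNewton_hTwo.cauchy isNewton_hTwo) using 1
    funext j
    rcases Nat.even_or_odd' j with ⟨m, rfl | rfl⟩ <;> simp [pow_succ]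
  rw [altSquare_eq_cauchy, this, double_two_mul]

lemma q_zero : q 0 = 1 := isNewton_q.1

lemma hTwo_zero : hTwo 0 = 1 := isNewton_hTwo.1

end GeneratingFunctions

/-! ### Leading terms of Schur functions and of Schur's `Q`-functions -/

section LeadingTerms

lemma coe_partsList (α : Multiset ℕ) : (partsList α : Multiset ℕ) = α := Multiset.sort_eq _ _

lemma strictAnti_sub_index (l : List ℕ) (hl : l.Pairwise (· ≥ ·)) :
    StrictAnti fun i : Fin l.length => (l.get i : ℤ) - (i : ℤ) := by
  intro i j hij
  have := List.pairwise_iff_get.1 hl i j hij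
  have h2 : (i : ℕ) < j := hij
  simp only
  omega

/-- The identity permutation contributes the leading product. For any other σ the sum of squares
grows by 2∑(λ_i - i)(σ(i) - i), which is positive by the strict rearrangement inequality since λ_i -
i is strictly decreasing. -/
lemma hasLeading_det (l : List ℕ) (hl : l.Pairwise (· ≥ ·)) :
    HasLeading h sq 1 (l : Multiset ℕ) (Matrix.det (Matrix.of fun i j : Fin l.length =>
      hInt ((l.get i : ℤ) - (i : ℤ) + (j : ℤ)))) := by
  have hid : ∏ i : Fin l.length, hInt ((l.get i : ℤ) - (i : ℤ) + (i : ℤ)) = monOf h l := by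
    have h1 : (l : Multiset ℕ) = Finset.univ.val.map l.get := by
      simp [Fin.univ_val_map]
    rw [h1, monOf, Multiset.map_map, Finset.prod_map_val]
    simp [hInt]
  unfold HasLeading
  rw [← Matrix.det_transpose, Matrix.det_apply, ← Finset.add_sum_erase _ _ (Finset.mem_univ 1)]
  simp only [Equiv.Perm.sign_one, one_smul, Equiv.Perm.one_apply, Matrix.transpose_apply,
    Matrix.of_apply]
  rw [hid, add_sub_cancel_left]
  refine Submodule.sum_mem _ fun σ hσ => ?_
  have hσ : σ ≠ 1 := by simpa using hσ
  rw [Units.smul_def]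
  refine Submodule.smul_mem _ _ ?_
  by_cases hneg : ∀ i : Fin l.length, 0 ≤ (l.get i : ℤ) - (i : ℤ) + (σ i : ℤ)
  · let f : Fin l.length → ℕ := fun i => ((l.get i : ℤ) - (i : ℤ) + (σ i : ℤ)).toNat
    have hf : ∀ i, (f i : ℤ) = (l.get i : ℤ) - (i : ℤ) + (σ i : ℤ) := fun i =>
      Int.toNat_of_nonneg (hneg i)
    have hprod : ∏ i : Fin l.length, hInt ((l.get i : ℤ) - (i : ℤ) + (σ i : ℤ)) =
        monOf h (Finset.univ.val.map f) := by
      rw [monOf, Multiset.map_map, Finset.prod_map_val]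
      refine Finset.prod_congr rfl fun i _ => ?_
      rw [← hf]
      simp [hInt]
    rw [hprod]
    have hl1 : (l : Multiset ℕ) = Finset.univ.val.map l.get := by
      simp [Fin.univ_val_map]
    have hsum : ∑ i : Fin l.length, ((σ i : ℕ) : ℤ) = ∑ i : Fin l.length, ((i : ℕ) : ℤ) :=
      Equiv.sum_comp σ fun i : Fin l.length => ((i : ℕ) : ℤ)
    have hsum2 : ∑ i : Fin l.length, ((σ i : ℕ) : ℤ) ^ 2 =
        ∑ i : Fin l.length, ((i : ℕ) : ℤ) ^ 2 :=
      Equiv.sum_comp σ fun i : Fin l.length => ((i : ℕ) : ℤ) ^ 2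
    apply monOf_mem_above
    · rw [hl1]
      show ∑ i, f i = ∑ i, l.get i
      have : ((∑ i, f i : ℕ) : ℤ) = (∑ i, l.get i : ℕ) := by
        push_cast
        simp only [hf, Finset.sum_add_distrib, Finset.sum_sub_distrib, hsum]
        ring
      exact_mod_cast this
    · rw [hl1, Multiset.map_map, Multiset.map_map]
      show ∑ i, (l.get i : ℤ) ^ 2 < ∑ i, (f i : ℤ) ^ 2
      have hanti := strictAnti_sub_index l hl
      have key : ∑ i : Fin l.length, ((l.get i : ℤ) - (i : ℤ)) * ((i : ℕ) : ℤ) <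
          ∑ i : Fin l.length, ((l.get i : ℤ) - (i : ℤ)) * ((σ i : ℕ) : ℤ) := by
        have hav : Antivary (fun i : Fin l.length => (l.get i : ℤ) - (i : ℤ))
            (fun i : Fin l.length => ((i : ℕ) : ℤ)) := by
          intro i j hij
          have : i < j := by simpa using hij
          exact (hanti this).le
        -- Equality in the rearrangement inequality would make σ monotone, hence the identity.
        refine hav.sum_mul_lt_sum_mul_comp_perm_iff.2 fun hc => hσ ?_
        have hmono : Monotone σ := by
          intro i j hij
          by_contra hlt
          push Not at hlt
          have h1 := hc (i := j) (j := i) (by simpa using hlt)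
          have h2 : j ≤ i := hanti.le_iff_ge.1 h1
          have : i = j := le_antisymm hij h2
          simp [this] at hlt
        have hs : StrictMono σ := hmono.strictMono_of_injective σ.injective
        have := Subsingleton.elim (hs.orderIsoOfSurjective σ σ.surjective)
          (OrderIso.refl (Fin l.length))
        ext i
        exact congrArg Fin.val (DFunLike.congr_fun this i)
      have e1 : ∑ i : Fin l.length, (f i : ℤ) ^ 2 - ∑ i : Fin l.length, (l.get i : ℤ) ^ 2 =
          2 * (∑ i : Fin l.length, ((l.get i : ℤ) - (i : ℤ)) * ((σ i : ℕ) : ℤ) -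
            ∑ i : Fin l.length, ((l.get i : ℤ) - (i : ℤ)) * ((i : ℕ) : ℤ)) +
          (∑ i : Fin l.length, ((σ i : ℕ) : ℤ) ^ 2 - ∑ i : Fin l.length, ((i : ℕ) : ℤ) ^ 2) := by
        rw [← Finset.sum_sub_distrib, ← Finset.sum_sub_distrib, ← Finset.sum_sub_distrib,
          Finset.mul_sum, ← Finset.sum_add_distrib]
        refine Finset.sum_congr rfl fun i _ => ?_
        rw [hf]
        ring
      rw [hsum2, sub_self] at e1
      linarith
  · push Not at hneg
    obtain ⟨i, hi⟩ := hneg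
    rw [Finset.prod_eq_zero (Finset.mem_univ i)]
    · exact zero_mem _
    · exact if_neg (not_le.2 hi)

lemma hasLeading_schurS (α : Multiset ℕ) : HasLeading h sq 1 α (schurS α) := by
  have := hasLeading_det (partsList α) (Multiset.pairwise_sort _ _)
  rwa [coe_partsList] at this

lemma hasLeading_qTwo {a b : ℕ} (hab : b ≤ a) : HasLeading q sq 1 {a, b} (qTwo a b) := by
  have e0 : monOf q {a, b} = q a * q b := by simp [Multiset.insert_eq_cons]
  rw [HasLeading, one_smul, e0, qTwo, add_sub_cancel_left, Finset.mul_sum]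
  refine Submodule.sum_mem _ fun i hi => ?_
  have hi : 1 ≤ i ∧ i ≤ b := by simpa using hi
  have e1 : 2 * ((-1) ^ i * (q (a + i) * q (b - i))) =
      (2 * (-1) ^ i : ℤ) • monOf q {a + i, b - i} := by
    simp [Multiset.insert_eq_cons, zsmul_eq_mul, mul_assoc]
  rw [e1]
  apply Submodule.smul_mem
  apply monOf_mem_above
  · simp [Multiset.insert_eq_cons]; omega
  · simp only [Multiset.insert_eq_cons, Multiset.map_cons, Multiset.map_singleton,
      Multiset.sum_cons, Multiset.sum_singleton, sq]
    have h1 : ((b - i : ℕ) : ℤ) = b - i := by omega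
    rw [h1]
    push_cast
    have h2 : (1 : ℤ) ≤ i := by exact_mod_cast hi.1
    have h3 : (b : ℤ) ≤ a := by exact_mod_cast hab
    nlinarith

lemma sum_neg_one_pow_fin {n : ℕ} (hn : Odd n) : ∑ i : Fin n, (-1 : ℤ) ^ (i : ℕ) = 1 := by
  rw [Fin.sum_univ_eq_sum_range (fun i => (-1 : ℤ) ^ i), neg_one_geom_sum,
    if_neg (Nat.not_even_iff_odd.2 hn)]

/-- Every term of the row expansion has the same leading product, with sign (-1)^i. There is an odd
number of terms, so the signs add up to 1. -/
lemma hasLeading_pfaffian (l : List ℕ) (hl : l.Pairwise (· ≥ ·)) (he : Even l.length) :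
    HasLeading q sq 1 (l : Multiset ℕ) (pfaffian qTwo l) := by
  induction hk : l.length using Nat.strong_induction_on generalizing l with
  | _ k ih =>
    match l, hl, he with
    | [], _, _ => simp [pfaffian, HasLeading]
    | a :: l, hl, he =>
      have ho : Odd l.length := by
        rw [List.length_cons] at he
        grind
      rw [pfaffian, ← sum_neg_one_pow_fin ho]
      refine HasLeading.sum _ fun i _ => ?_
      have h1 : (↑(a :: l) : Multiset ℕ) = {a, l.get i} + ↑(l.eraseIdx i) := by
        have h2 := List.getElem_cons_eraseIdx_perm (l := l) (n := i) i.2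
        rw [← Multiset.cons_coe, ← Multiset.coe_eq_coe.2 h2]
        rfl
      rw [List.pairwise_cons] at hl
      have hlen : (l.eraseIdx i).length = l.length - 1 := List.length_eraseIdx_of_lt i.2
      have h3 := ih (l.eraseIdx i).length (by simp at hk; omega) (l.eraseIdx i)
        (hl.2.sublist (List.eraseIdx_sublist _ _)) (by rw [hlen]; grind) rfl
      have h4 := (hasLeading_qTwo (hl.1 _ (List.get_mem l i))).mul h3
      rw [← h1] at h4
      have h5 := h4.zsmul ((-1) ^ (i : ℕ))
      convert h5 using 1
      · ring
      · simp [zsmul_eq_mul, mul_assoc]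

lemma hasLeading_schurQ (α : Multiset ℕ) : HasLeading q sq 1 α (schurQ α) := by
  have hs := Multiset.pairwise_sort α (· ≥ ·)
  have hlen : (partsList α).length = α.card := by rw [← Multiset.coe_card, coe_partsList]
  unfold schurQ
  split_ifs with he
  · have := hasLeading_pfaffian (partsList α) hs (by rwa [hlen])
    rwa [coe_partsList] at this
  · have h1 := hasLeading_pfaffian (partsList α ++ [0])
      (List.pairwise_append.2 ⟨hs, by simp, by simp⟩)
      (by rw [List.length_append, hlen]; simp; grind)
    rw [← Multiset.coe_add, coe_partsList] at h1
    have h2 : ((↑[0] : Multiset ℕ)) = {0} := rfl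
    rw [h2] at h1
    -- The appended part 0 is invisible: q_0 = 1, and it adds nothing to size or weight.
    simpa [HasLeading, monOf_add, q_zero] using h1

/-- Inverts the unitriangular Jacobi-Trudi expansion over ℤ; zero parts are dropped because h_0 = 1.
-/
lemma monOf_h_mem_of_schurS {B : Submodule ℤ V} {s : ℕ}
    (hB : ∀ ρ : s.Partition, schurS ρ.parts ∈ B) {α : Multiset ℕ} (hα : α.sum = s) :
    monOf h α ∈ B := by
  refine monOf_mem_of_above ?_ α hα
  intro α hα hab
  rw [← monOf_filter_ne_zero h_zero]
  set β := α.filter (· ≠ 0) with hβ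
  have hs : β.sum = s := by rw [← hα]; exact sum_filter_ne_zero α
  have h1 := hasLeading_schurS β
  rw [HasLeading, hs, hβ, sum_map_filter_ne_zero sq_zero, ← hβ, one_smul] at h1
  have h2 := hB ⟨β, fun {i} hi => Nat.pos_of_ne_zero (Multiset.mem_filter.1 hi).2, hs⟩
  have := sub_mem h2 (hab h1)
  simpa using this

lemma monOf_q_mem_of_schurQ {B : Submodule ℤ V} {s : ℕ}
    (hB : ∀ ρ : s.Partition, ρ.parts.Nodup → schurQ ρ.parts ∈ B) {α : Multiset ℕ}
    (hα : α.sum = s) : monOf q α ∈ B := by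
  refine monOf_mem_of_above ?_ α hα
  intro α hα hab
  by_cases hnd : (α.filter (· ≠ 0)).Nodup
  · rw [← monOf_filter_ne_zero q_zero]
    set β := α.filter (· ≠ 0) with hβ
    have hs : β.sum = s := by rw [← hα]; exact sum_filter_ne_zero α
    have h1 := hasLeading_schurQ β
    rw [HasLeading, hs, hβ, sum_map_filter_ne_zero sq_zero, ← hβ, one_smul] at h1
    have h2 := hB ⟨β, fun {i} hi => Nat.pos_of_ne_zero (Multiset.mem_filter.1 hi).2, hs⟩ hnd
    have := sub_mem h2 (hab h1)
    simpa using this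
  · rw [Multiset.nodup_iff_le] at hnd
    push Not at hnd
    obtain ⟨m, hm⟩ := hnd
    have hm0 : m ≠ 0 := by
      have : m ∈ α.filter (· ≠ 0) := Multiset.mem_of_le hm (by simp)
      simpa using (Multiset.mem_filter.1 this).2
    obtain ⟨γ, hγ⟩ := Multiset.le_iff_exists_add.1 (hm.trans (Multiset.filter_le _ _))
    have hα2 : α = {m, m} + γ := hγ
    have h1 := monOf_mul_above γ (altSquare_sub_mem q m)
    have h2 : above q sq (γ.sum + 2 * m)
        ((γ.map sq).sum + (({m, m} : Multiset ℕ).map sq).sum) ≤ B := by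
      convert hab using 2
      · rw [← hα, hα2]; simp [Multiset.insert_eq_cons]; omega
      · rw [hα2, Multiset.map_add, Multiset.sum_add, add_comm]
    -- Since `altSquare q m` vanishes, q_m² is itself a combination of heavier products.
    have h3 := Submodule.smul_mem _ (-(-1 : ℤ) ^ m) (h2 h1)
    convert h3 using 1
    rw [altSquare_q hm0, hα2, monOf_add]
    simp only [zsmul_eq_mul]
    push_cast
    have : ((-1 : V) ^ m) * (-1) ^ m = 1 := by rw [← mul_pow]; simp
    linear_combination (-(monOf q {m, m} * monOf q γ)) * this

end LeadingTerms

/-! ### The maps `λ ↦ λ^r`, `λ ↦ λ^d` and the Glaisher map -/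

section Partitions

lemma count_rPart (α : Multiset ℕ) (i : ℕ) : (rPart α).count i = α.count i % 2 := by
  have hnd : (rPart α).Nodup := Finset.nodup _
  rw [Multiset.count_eq_of_nodup hnd]
  have : i ∈ rPart α ↔ Odd (α.count i) := by
    simp only [rPart, Finset.mem_val, Finset.mem_filter, Multiset.mem_toFinset,
      and_iff_right_iff_imp]
    intro h
    by_contra hi
    simp [Multiset.count_eq_zero_of_notMem hi] at h
  simp only [this]
  grind

lemma count_dPart (α : Multiset ℕ) (i : ℕ) : (dPart α).count i = α.count i / 2 := by
  simp only [dPart, Multiset.count_sum', Multiset.count_replicate]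
  rw [Finset.sum_ite_eq']
  split_ifs with h
  · rfl
  · simp [Multiset.count_eq_zero_of_notMem (a := i) (s := α) (by simpa using h)]

/-- With the next two lemmas, this identifies partitions of n with pairs (strict α, arbitrary β)
such that |α| + 2|β| = n. -/
lemma rPart_add_two_nsmul_dPart (α : Multiset ℕ) : rPart α + 2 • dPart α = α := by
  ext i
  simp only [Multiset.count_add, Multiset.count_nsmul, count_rPart, count_dPart]
  omega

lemma rPart_add_two_nsmul {α : Multiset ℕ} (hα : α.Nodup) (β : Multiset ℕ) :
    rPart (α + 2 • β) = α := by
  ext i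
  have := Multiset.nodup_iff_count_le_one.1 hα i
  simp only [Multiset.count_add, Multiset.count_nsmul, count_rPart]
  omega

lemma dPart_add_two_nsmul {α : Multiset ℕ} (hα : α.Nodup) (β : Multiset ℕ) :
    dPart (α + 2 • β) = β := by
  ext i
  have := Multiset.nodup_iff_count_le_one.1 hα i
  simp only [Multiset.count_add, Multiset.count_nsmul, count_dPart]
  omega

lemma nodup_rPart (α : Multiset ℕ) : (rPart α).Nodup := Finset.nodup _

lemma sum_rPart_add (α : Multiset ℕ) : (rPart α).sum + 2 * (dPart α).sum = α.sum := by
  conv_rhs => rw [← rPart_add_two_nsmul_dPart α]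
  simp [two_nsmul, two_mul]

lemma sum_map_rPart_add {M : Type*} [AddCommMonoid M] (e : ℕ → M) (α : Multiset ℕ) :
    ((rPart α).map e).sum + 2 • ((dPart α).map e).sum = (α.map e).sum := by
  conv_rhs => rw [← rPart_add_two_nsmul_dPart α]
  simp [two_nsmul]

/-- The partition `α ∪ β ∪ β`. -/
def joinPartition {n : ℕ} (α β : Multiset ℕ) (hα : 0 ∉ α) (hβ : 0 ∉ β)
    (hn : α.sum + 2 * β.sum = n) : n.Partition where
  parts := α + 2 • β
  parts_pos := by
    intro i hi
    rcases Multiset.mem_add.1 hi with h | h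
    · exact Nat.pos_of_ne_zero (by rintro rfl; exact hα h)
    · have h := Multiset.mem_of_mem_nsmul h
      exact Nat.pos_of_ne_zero (by rintro rfl; exact hβ h)
  parts_sum := by simpa [two_nsmul, two_mul] using hn

lemma zero_notMem_of_le {n : ℕ} (ρ : n.Partition) {α : Multiset ℕ} (h : α ≤ ρ.parts) : 0 ∉ α :=
  fun h0 => absurd (ρ.parts_pos (Multiset.mem_of_le h h0)) (lt_irrefl 0)

lemma zero_notMem_rPart {n : ℕ} (ρ : n.Partition) : 0 ∉ rPart ρ.parts := by
  refine zero_notMem_of_le ρ (Multiset.le_iff_count.2 fun i => ?_)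
  rw [count_rPart]; omega

lemma zero_notMem_dPart {n : ℕ} (ρ : n.Partition) : 0 ∉ dPart ρ.parts := by
  refine zero_notMem_of_le ρ (Multiset.le_iff_count.2 fun i => ?_)
  rw [count_dPart]; omega

lemma card_dPart {n : ℕ} (ρ : n.Partition) :
    (dPart ρ.parts).card = ∑ i ∈ Finset.range n, ρ.parts.count (i + 1) / 2 := by
  rw [← sum_parts_toFinset ρ (fun j => ρ.parts.count j / 2)
    (fun j hj => by simp [Multiset.count_eq_zero_of_notMem hj])]
  simp [dPart, Multiset.card_sum]

lemma sum_map_rPart {n : ℕ} (ρ : n.Partition) (f : ℕ → ℕ) :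
    ((rPart ρ.parts).map f).sum =
      ∑ i ∈ Finset.range n, (ρ.parts.count (i + 1) % 2) * f (i + 1) := by
  rw [← sum_parts_toFinset ρ (fun j => (ρ.parts.count j % 2) * f j)
    (fun j hj => by simp [Multiset.count_eq_zero_of_notMem hj])]
  rw [rPart, Finset.sum_map_val, Finset.sum_filter]
  refine Finset.sum_congr rfl fun i _ => ?_
  split_ifs with h
  · rw [Nat.odd_iff.1 h, one_mul]
  · rw [Nat.not_odd_iff.1 h, zero_mul]

lemma card_glaisher (α : Multiset ℕ) :
    (glaisher α).card = (α.map fun a => ordProj[2] a).sum := by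
  simp [glaisher, Multiset.card_bind]

/-- Trading `k` parts `2i` for `2k` parts `i`. -/
lemma card_count_two_mul (n i k : ℕ) (hi : i ≠ 0) :
    (Finset.univ.filter fun ρ : n.Partition => 2 * k ≤ ρ.parts.count i).card =
      (Finset.univ.filter fun ρ : n.Partition => k ≤ ρ.parts.count (2 * i)).card := by
  have key : ∀ (a b c d : ℕ), b ≠ 0 → c * a = d * b → ∀ ρ : n.Partition, c ≤ ρ.parts.count a →
      ∃ σ : n.Partition, σ.parts + Multiset.replicate c a = ρ.parts + Multiset.replicate d b := by
    -- Swapping c parts a for d parts b preserves the size and is undone by the reverse swap; the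
    -- two directions give the two inequalities.
    intro a b c d hb hcd ρ hρ
    have hle : Multiset.replicate c a ≤ ρ.parts := Multiset.le_count_iff_replicate_le.1 hρ
    refine ⟨⟨ρ.parts - Multiset.replicate c a + Multiset.replicate d b, ?_, ?_⟩, ?_⟩
    · intro j hj
      rcases Multiset.mem_add.1 hj with h | h
      · exact ρ.parts_pos (Multiset.mem_of_le (Multiset.sub_le_self _ _) h)
      · rw [Multiset.eq_of_mem_replicate h]; omega
    · have h1 := congrArg Multiset.sum (Multiset.sub_add_cancel hle)
      simp only [Multiset.sum_add, Multiset.sum_replicate, smul_eq_mul, ρ.parts_sum] at h1 ⊢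
      omega
    · rw [add_right_comm, Multiset.sub_add_cancel hle]
  have hne : i ≠ 2 * i := by omega
  apply le_antisymm
  · choose! F hF using key i (2 * i) (2 * k) k (by omega) (by ring)
    refine Finset.card_le_card_of_injOn F ?_ ?_
    · intro ρ hρ
      have hρ : 2 * k ≤ ρ.parts.count i := by simpa using hρ
      have := congrArg (Multiset.count (2 * i)) (hF ρ hρ)
      simp [Multiset.count_replicate, hne] at this
      simp [this]
    · intro ρ hρ σ hσ h
      have hρ : 2 * k ≤ ρ.parts.count i := by simpa using hρ
      have hσ : 2 * k ≤ σ.parts.count i := by simpa using hσ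
      have h1 := hF ρ hρ
      rw [h, hF σ hσ] at h1
      exact Nat.Partition.ext (add_right_cancel h1).symm
  · choose! F hF using key (2 * i) i k (2 * k) hi (by ring)
    refine Finset.card_le_card_of_injOn F ?_ ?_
    · intro ρ hρ
      have hρ : k ≤ ρ.parts.count (2 * i) := by simpa using hρ
      have := congrArg (Multiset.count i) (hF ρ hρ)
      simp [Multiset.count_replicate, hne.symm] at this
      simp [this]
    · intro ρ hρ σ hσ h
      have hρ : k ≤ ρ.parts.count (2 * i) := by simpa using hρ
      have hσ : k ≤ σ.parts.count (2 * i) := by simpa using hσ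
      have h1 := hF ρ hρ
      rw [h, hF σ hσ] at h1
      exact Nat.Partition.ext (add_right_cancel h1).symm

lemma count_mul_le {n : ℕ} (ρ : n.Partition) (i : ℕ) :
    ρ.parts.count i * i ≤ n := by
  have h1 : Multiset.replicate (ρ.parts.count i) i ≤ ρ.parts :=
    Multiset.le_count_iff_replicate_le.1 le_rfl
  obtain ⟨γ, hγ⟩ := Multiset.le_iff_exists_add.1 h1
  have := congrArg Multiset.sum hγ
  simp only [Multiset.sum_add, Multiset.sum_replicate, smul_eq_mul, ρ.parts_sum] at this
  omega

/-- Each multiplicity is written as the number of thresholds k + 1 it reaches; `card_count_two_mul`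
matches the counts threshold by threshold. -/
lemma sum_count_div_two (n i : ℕ) (hi : i ≠ 0) :
    ∑ ρ : n.Partition, ρ.parts.count i / 2 = ∑ ρ : n.Partition, ρ.parts.count (2 * i) := by
  have h0 : ∀ m ≤ n, m = ∑ k ∈ Finset.range n, if k + 1 ≤ m then 1 else 0 := by
    intro m hm
    rw [Finset.sum_boole, Nat.cast_id]
    have : (Finset.range n).filter (fun k => k + 1 ≤ m) = Finset.range m := by
      ext k; simp; omega
    rw [this, Finset.card_range]
  have h1 : ∀ ρ : n.Partition, ∀ j ≠ 0, ρ.parts.count j ≤ n := fun ρ j hj =>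
    (Nat.le_mul_of_pos_right _ (Nat.pos_of_ne_zero hj)).trans (count_mul_le ρ j)
  have h2 : ∀ ρ : n.Partition, ρ.parts.count i / 2 =
      ∑ k ∈ Finset.range n, if 2 * (k + 1) ≤ ρ.parts.count i then 1 else 0 := by
    intro ρ
    rw [h0 (ρ.parts.count i / 2) (by have := h1 ρ i hi; omega)]
    exact Finset.sum_congr rfl fun k _ => by congr 1; simp; omega
  have h3 : ∀ ρ : n.Partition, ρ.parts.count (2 * i) =
      ∑ k ∈ Finset.range n, if k + 1 ≤ ρ.parts.count (2 * i) then 1 else 0 :=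
    fun ρ => h0 _ (h1 ρ _ (by omega))
  rw [Finset.sum_congr rfl fun ρ _ => h2 ρ, Finset.sum_congr rfl fun ρ _ => h3 ρ,
    Finset.sum_comm, Finset.sum_comm (s := Finset.univ)]
  refine Finset.sum_congr rfl fun k _ => ?_
  rw [Finset.sum_boole, Finset.sum_boole, card_count_two_mul n i (k + 1) hi]

/-- Let a_i be the total number of parts i over P(n), and g(i) the 2-part of i. Part i has odd
multiplicity in a_i - 2a_(2i) partitions, so the right side is ∑(g(i) - 1)(a_i - 2a_(2i)). Odd i
have g(i) = 1, and g(2i) = 2g(i); the sum collapses to ∑ a_(2i), which is the left side. -/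
lemma sum_card_dPart (n : ℕ) :
    ((∑ ρ : n.Partition, (dPart ρ.parts).card : ℕ) : ℤ) =
      ∑ ρ : n.Partition,
        (((glaisher (rPart ρ.parts)).card : ℤ) - ((rPart ρ.parts).card : ℤ)) := by
  let a : ℕ → ℤ := fun i => ∑ ρ : n.Partition, (ρ.parts.count i : ℤ)
  have hd : ((∑ ρ : n.Partition, (dPart ρ.parts).card : ℕ) : ℤ) =
      ∑ i ∈ Finset.range n, a (2 * (i + 1)) := by
    simp only [card_dPart]
    rw [Finset.sum_comm]
    push_cast
    refine Finset.sum_congr rfl fun i _ => ?_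
    have := sum_count_div_two n (i + 1) (by omega)
    simp only [a]
    exact_mod_cast this
  have ho : ∀ i ≠ 0, ∑ ρ : n.Partition, ((ρ.parts.count i % 2 : ℕ) : ℤ) = a i - 2 * a (2 * i) := by
    intro i hi
    have h1 : a (2 * i) = ∑ ρ : n.Partition, ((ρ.parts.count i / 2 : ℕ) : ℤ) := by
      simp only [a]
      exact_mod_cast (sum_count_div_two n i hi).symm
    rw [h1, Finset.mul_sum, ← Finset.sum_sub_distrib]
    exact Finset.sum_congr rfl fun ρ _ => by omega
  have hcard : ∀ ρ : n.Partition, ((rPart ρ.parts).card : ℤ) =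
      ∑ i ∈ Finset.range n, ((ρ.parts.count (i + 1) % 2 : ℕ) : ℤ) := by
    intro ρ
    have := sum_map_rPart ρ (fun _ => 1)
    simp only [Multiset.map_const', Multiset.sum_replicate, smul_eq_mul, mul_one] at this
    rw [this, Nat.cast_sum]
  have hgl : ∀ ρ : n.Partition, ((glaisher (rPart ρ.parts)).card : ℤ) =
      ∑ i ∈ Finset.range n, ((ρ.parts.count (i + 1) % 2 : ℕ) : ℤ) *
        ((ordProj[2] (i + 1) : ℕ) : ℤ) := by
    intro ρ
    rw [card_glaisher, sum_map_rPart]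
    push_cast
    rfl
  have ha0 : ∀ i, n < i → a i = 0 := by
    intro i hi
    refine Finset.sum_eq_zero fun ρ _ => ?_
    have : i ∉ ρ.parts := fun h => absurd (ρ.le_of_mem_parts h) (by omega)
    simp [Multiset.count_eq_zero_of_notMem this]
  have hg : ∀ i ≠ 0, ((ordProj[2] (2 * i) : ℕ) : ℤ) = 2 * ((ordProj[2] i : ℕ) : ℤ) := by
    intro i hi
    rw [Nat.factorization_mul (by norm_num) hi]
    simp [Nat.Prime.factorization_self Nat.prime_two, pow_add]
  -- The range can be doubled because no part exceeds n; it can then be split by parity.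
  have heven : ∀ f : ℕ → ℤ, ∑ i ∈ Finset.range (2 * n), f (i + 1) * a (i + 1) =
      ∑ i ∈ Finset.range n, f (i + 1) * a (i + 1) := by
    intro f
    symm
    refine Finset.sum_subset (Finset.range_mono (by omega)) fun i _ hi => ?_
    rw [ha0 (i + 1) (by simp at hi; omega), mul_zero]
  have hodd : ∀ f : ℕ → ℤ, (∀ i, f (2 * i + 1) = 0) →
      ∑ i ∈ Finset.range n, f (i + 1) * a (i + 1) =
      ∑ i ∈ Finset.range n, f (2 * (i + 1)) * a (2 * (i + 1)) := by
    intro f hf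
    rw [← heven, sum_range_two_mul]
    refine Finset.sum_congr rfl fun i _ => ?_
    rw [hf, zero_mul, zero_add]
    rfl
  have hterm : ∀ i ∈ Finset.range n,
      (∑ ρ : n.Partition, ((ρ.parts.count (i + 1) % 2 : ℕ) : ℤ) * ((ordProj[2] (i + 1) : ℕ) : ℤ) -
        ∑ ρ : n.Partition, ((ρ.parts.count (i + 1) % 2 : ℕ) : ℤ)) =
      (((ordProj[2] (i + 1) : ℕ) : ℤ) - 1) * a (i + 1) -
        (2 * ((ordProj[2] (i + 1) : ℕ) : ℤ) - 2) * a (2 * (i + 1)) := by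
    intro i _
    rw [← Finset.sum_mul, ho (i + 1) (by omega)]
    ring
  have hr : ∑ ρ : n.Partition,
        (((glaisher (rPart ρ.parts)).card : ℤ) - ((rPart ρ.parts).card : ℤ)) =
      ∑ i ∈ Finset.range n, ((((ordProj[2] (i + 1) : ℕ) : ℤ) - 1) * a (i + 1) -
        (2 * ((ordProj[2] (i + 1) : ℕ) : ℤ) - 2) * a (2 * (i + 1))) := by
    simp only [hgl, hcard]
    rw [Finset.sum_sub_distrib, Finset.sum_comm, Finset.sum_comm (s := Finset.univ),
      ← Finset.sum_sub_distrib]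
    exact Finset.sum_congr rfl hterm
  rw [hd, hr, Finset.sum_sub_distrib, hodd (fun i => ((ordProj[2] i : ℕ) : ℤ) - 1), ← Finset.sum_sub_distrib]
  · refine Finset.sum_congr rfl fun i _ => ?_
    rw [hg (i + 1) (by omega)]
    ring
  · intro i
    rw [Nat.factorization_eq_zero_of_not_dvd (by omega)]
    simp

end Partitions

/-! ### Integral transition matrices -/

section Matrices

variable {ι M : Type*} [Fintype ι] [AddCommGroup M]

lemma exists_matrix_of_mem_span {f g : ι → M} (h : ∀ i, f i ∈ Submodule.span ℤ (Set.range g)) :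
    ∃ A : Matrix ι ι ℤ, ∀ i, f i = ∑ j, A i j • g j := by
  choose A hA using fun i => (Submodule.mem_span_range_iff_exists_fun ℤ).1 (h i)
  exact ⟨A, fun i => (hA i).symm⟩

lemma eq_sum_matrix_mul {f g k : ι → M} {A B : Matrix ι ι ℤ} (hf : ∀ i, f i = ∑ j, A i j • g j)
    (hg : ∀ i, g i = ∑ j, B i j • k j) (i : ι) : f i = ∑ j, (A * B) i j • k j := by
  simp only [hf i, hg, Finset.smul_sum, Matrix.mul_apply, Finset.sum_smul, mul_smul]
  exact Finset.sum_comm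

/-- A dimension count: both families have the same finite index set. -/
lemma linearIndependent_of_mem_span [Module ℚ M] {f g : ι → M} (hf : LinearIndependent ℚ f)
    (h : ∀ i, f i ∈ Submodule.span ℚ (Set.range g)) : LinearIndependent ℚ g := by
  rw [linearIndependent_iff_card_le_finrank_span, linearIndependent_iff_card_eq_finrank_span.1 hf]
  have : Module.Finite ℚ (Submodule.span ℚ (Set.range g)) :=
    FiniteDimensional.span_of_finite ℚ (Set.finite_range g)
  exact Submodule.finrank_mono (Submodule.span_le.2 (by rintro _ ⟨i, rfl⟩; exact h i))

lemma linearIndependent_of_mem_int_span [Module ℚ M] {f g : ι → M} (hf : LinearIndependent ℚ f)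
    (h : ∀ i, f i ∈ Submodule.span ℤ (Set.range g)) : LinearIndependent ℚ g :=
  linearIndependent_of_mem_span hf fun i =>
    Submodule.span_subset_span ℤ ℚ (Set.range g) (h i)

variable [DecidableEq ι]

lemma exists_unimodular_matrix [Module ℚ M] {f g : ι → M} (hg : LinearIndependent ℚ g)
    (h1 : ∀ i, f i ∈ Submodule.span ℤ (Set.range g))
    (h2 : ∀ i, g i ∈ Submodule.span ℤ (Set.range f)) :
    ∃ A : Matrix ι ι ℤ, (∀ i, f i = ∑ j, A i j • g j) ∧ |A.det| = 1 := by
  obtain ⟨A, hA⟩ := exists_matrix_of_mem_span h1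
  obtain ⟨B, hB⟩ := exists_matrix_of_mem_span h2
  refine ⟨A, hA, ?_⟩
  have hz : LinearIndependent ℤ g :=
    hg.restrict_scalars' ℤ
  have hBA : B * A = 1 := by
    ext i j
    have e1 : ∑ j, (B * A) i j • g j = ∑ j, (1 : Matrix ι ι ℤ) i j • g j := by
      rw [← eq_sum_matrix_mul hB hA]
      simp [Matrix.one_apply]
    have := Fintype.linearIndependent_iff.1 hz (fun j => (B * A) i j - (1 : Matrix ι ι ℤ) i j)
      (by simp only [sub_smul, Finset.sum_sub_distrib, e1, sub_self]) j
    linarith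
  have hdet := congrArg Matrix.det hBA
  rw [Matrix.det_mul, Matrix.det_one] at hdet
  exact Int.isUnit_iff_abs_eq.1 (IsUnit.of_mul_eq_one_right _ hdet)

/-- The weight need not be injective: distinct indices of equal weight also give zero entries, so
the diagonal blocks are diagonal matrices. -/
lemma det_of_triangular {wt : ι → ℤ} (D : Matrix ι ι ℤ)
    (hD : ∀ i j, i ≠ j → wt i ≤ wt j → D i j = 0) : D.det = ∏ i, D i i := by
  have ht : D.BlockTriangular fun i => -wt i := by
    intro i j hij
    have hij : -wt j < -wt i := hij
    exact hD i j (by rintro rfl; exact lt_irrefl _ hij) (by linarith)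
  rw [ht.det, ← Finset.prod_fiberwise_of_maps_to (t := Finset.univ.image fun i => -wt i)
    (g := fun i => -wt i) (fun i _ => Finset.mem_image_of_mem _ (Finset.mem_univ i))]
  refine Finset.prod_congr rfl fun a _ => ?_
  have hdiag : D.toSquareBlock (fun i => -wt i) a = Matrix.diagonal fun i => D i.1 i.1 := by
    ext i j
    by_cases hij : i = j
    · subst hij; simp [Matrix.toSquareBlock_def]
    · rw [Matrix.diagonal_apply_ne _ hij, Matrix.toSquareBlock_def, Matrix.of_apply]
      refine hD _ _ (fun h => hij (Subtype.ext h)) ?_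
      have h1 := i.2
      have h2 := j.2
      linarith
  rw [hdiag, Matrix.det_diagonal, Finset.prod_subtype (p := fun i => -wt i = a) _ (by simp)]

lemma exists_triangular_matrix {f g : ι → M} (wt : ι → ℤ) (d : ι → ℤ)
    (h : ∀ i, f i - d i • g i ∈ Submodule.span ℤ (g '' {j | wt j < wt i})) :
    ∃ D : Matrix ι ι ℤ, (∀ i, f i = ∑ j, D i j • g j) ∧ D.det = ∏ i, d i := by
  have h1 : ∀ i, ∃ c : ι → ℤ, (∀ j, wt i ≤ wt j → c j = 0) ∧ f i - d i • g i = ∑ j, c j • g j := by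
    intro i
    obtain ⟨c, hc, hc2⟩ := (Finsupp.mem_span_image_iff_linearCombination ℤ).1 (h i)
    refine ⟨c, fun j hj => ?_, ?_⟩
    · by_contra hne
      have : wt j < wt i := (Finsupp.mem_supported ℤ c).1 hc (by simpa using hne)
      omega
    · rw [← hc2, Finsupp.linearCombination_apply, Finsupp.sum_fintype _ _ (by simp)]
  choose c hc hc2 using h1
  refine ⟨Matrix.of c + Matrix.diagonal d, fun i => ?_, ?_⟩
  · simp only [Matrix.add_apply, Matrix.of_apply, add_smul, Finset.sum_add_distrib, ← hc2]
    simp [Matrix.diagonal_apply]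
  · rw [det_of_triangular (wt := wt)]
    · simp [hc]
    · intro i j hij hw
      simp [hij, hc i j hw]

end Matrices

/-! ### Graded spans -/

section Spans

lemma mul_mem_span_of_forall {S A : Type*} [CommSemiring S] [Semiring A] [Algebra S A]
    {s t r : Set A} (h : ∀ x ∈ s, ∀ y ∈ t, x * y ∈ r) {x y : A} (hx : x ∈ Submodule.span S s)
    (hy : y ∈ Submodule.span S t) : x * y ∈ Submodule.span S r := by
  have h1 := Submodule.mul_mem_mul hx hy
  rw [Submodule.span_mul_span] at h1
  exact Submodule.span_mono (Set.mul_subset_iff.2 h) h1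

lemma monOf_mem_graded {S R : Type*} [CommRing S] [CommRing R] [Algebra S R]
    {L : ℕ → Submodule S R} (h1 : 1 ∈ L 0)
    (hm : ∀ i j x y, x ∈ L i → y ∈ L j → x * y ∈ L (i + j)) {u : ℕ → R} (k : ℕ)
    {α : Multiset ℕ} (hu : ∀ a ∈ α, u a ∈ L (k * a)) : monOf u α ∈ L (k * α.sum) := by
  induction α using Multiset.induction_on with
  | empty => simpa using h1
  | cons a α ih =>
    rw [monOf_cons, Multiset.sum_cons, mul_add]
    exact hm _ _ _ _ (hu a (by simp)) (ih fun b hb => hu b (by simp [hb]))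

variable {R : Type*} [CommRing R]

lemma one_mem_monSpan (u : ℕ → R) : 1 ∈ monSpan u 0 := Submodule.subset_span ⟨0, by simp⟩

lemma mul_mem_monSpan {u : ℕ → R} {s t : ℕ} {x y : R} (hx : x ∈ monSpan u s)
    (hy : y ∈ monSpan u t) : x * y ∈ monSpan u (s + t) := by
  refine mul_mem_span_of_forall ?_ hx hy
  rintro _ ⟨α, hα, rfl⟩ _ ⟨β, hβ, rfl⟩
  exact ⟨α + β, by simp [hα, hβ], monOf_add _ _ _⟩

lemma mem_monSpan (u : ℕ → R) (n : ℕ) : u n ∈ monSpan u n :=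
  Submodule.subset_span ⟨{n}, by simp⟩

/-- The integral span of the products `∏ u_{α_i} ∏ v_{β_i}` with `|α| + 2 |β| = n`. -/
def biSpan (u v : ℕ → R) (n : ℕ) : Submodule ℤ R :=
  Submodule.span ℤ
    {x | ∃ α β : Multiset ℕ, α.sum + 2 * β.sum = n ∧ monOf u α * monOf v β = x}

lemma one_mem_biSpan (u v : ℕ → R) : 1 ∈ biSpan u v 0 :=
  Submodule.subset_span ⟨0, 0, by simp⟩

lemma mul_mem_biSpan {u v : ℕ → R} {s t : ℕ} {x y : R} (hx : x ∈ biSpan u v s)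
    (hy : y ∈ biSpan u v t) : x * y ∈ biSpan u v (s + t) := by
  refine mul_mem_span_of_forall ?_ hx hy
  rintro _ ⟨α, β, h1, rfl⟩ _ ⟨γ, δ, h2, rfl⟩
  refine ⟨α + γ, β + δ, ?_, ?_⟩
  · simp only [Multiset.sum_add]; omega
  · simp only [monOf_add]; ring

lemma left_mem_biSpan (u v : ℕ → R) (n : ℕ) : u n ∈ biSpan u v n :=
  Submodule.subset_span ⟨{n}, 0, by simp⟩

lemma right_mem_biSpan (u v : ℕ → R) (n : ℕ) : v n ∈ biSpan u v (2 * n) :=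
  Submodule.subset_span ⟨0, {n}, by simp⟩

lemma mul_mem_biSpan_of_monSpan {u v : ℕ → R} {s t n : ℕ} {x y : R} (hx : x ∈ monSpan u s)
    (hy : y ∈ monSpan v t) (hn : s + 2 * t = n) : x * y ∈ biSpan u v n := by
  refine mul_mem_span_of_forall ?_ hx hy
  rintro _ ⟨α, hα, rfl⟩ _ ⟨β, hβ, rfl⟩
  exact ⟨α, β, by omega, rfl⟩

lemma biSpan_le {u u' v : ℕ → R} (hu : ∀ n, u n ∈ biSpan u' v n) (n : ℕ) :
    biSpan u v n ≤ biSpan u' v n := by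
  apply Submodule.span_le.2
  rintro _ ⟨α, β, h, rfl⟩
  have h1 := monOf_mem_graded (one_mem_biSpan u' v) (fun _ _ _ _ hx hy => mul_mem_biSpan hx hy)
    (u := u) 1 (α := α) (fun a _ => by simpa using hu a)
  have h2 := monOf_mem_graded (one_mem_biSpan u' v) (fun _ _ _ _ hx hy => mul_mem_biSpan hx hy)
    (u := v) 2 (α := β) (fun a _ => right_mem_biSpan u' v a)
  have := mul_mem_biSpan h1 h2
  rwa [one_mul, h] at this

/-- The products `∏ u_{(λ^r)_i} ∏ v_{(λ^d)_i}`. -/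
def rdProd (u v : ℕ → R) {n : ℕ} (ρ : n.Partition) : R :=
  monOf u (rPart ρ.parts) * monOf v (dPart ρ.parts)

lemma rdProd_joinPartition (u v : ℕ → R) {n : ℕ} {α β : Multiset ℕ} (hα : 0 ∉ α) (hβ : 0 ∉ β)
    (hn : α.sum + 2 * β.sum = n) (hnd : α.Nodup) :
    rdProd u v (joinPartition α β hα hβ hn) = monOf u α * monOf v β := by
  rw [rdProd, joinPartition, rPart_add_two_nsmul hnd, dPart_add_two_nsmul hnd]

lemma rdProd_mem_biSpan (u v : ℕ → R) {n : ℕ} (ρ : n.Partition) : rdProd u v ρ ∈ biSpan u v n :=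
  Submodule.subset_span ⟨_, _, by rw [sum_rPart_add, ρ.parts_sum], rfl⟩

/-- Repeated u-factors are traded for v-factors until the u-part is strict; a strict α and any β
then form the partition α ∪ β ∪ β. -/
lemma biSpan_le_span_rdProd {u v : ℕ → R} (hu : u 0 = 1) (hv : v 0 = 1)
    (huv : ∀ m, altSquare u m ∈ monSpan v m) (n : ℕ) :
    biSpan u v n ≤ Submodule.span ℤ (Set.range fun ρ : n.Partition => rdProd u v ρ) := by
  apply Submodule.span_le.2
  rintro _ ⟨α, β, hn, rfl⟩
  refine monOf_mul_mem_of_strict hu (C := monSpan v)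
    (fun m j c hc => mul_mem_monSpan (huv m) hc) (n := n) ?_ α β.sum _ (monOf_mem_monSpan v rfl) hn
  intro α j c hnd h0 hc hn
  set B := Submodule.span ℤ (Set.range fun ρ : n.Partition => rdProd u v ρ)
  have : monSpan v j ≤ B.comap (LinearMap.mulLeft ℤ (monOf u α)) := by
    apply Submodule.span_le.2
    rintro _ ⟨β, hβ, rfl⟩
    have hs : (β.filter (· ≠ 0)).sum = β.sum := sum_filter_ne_zero β
    show monOf u α * monOf v β ∈ B
    rw [← monOf_filter_ne_zero hv, ← rdProd_joinPartition u v h0 (by simp)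
      (by rw [hs, hβ, hn]) hnd]
    exact Submodule.subset_span ⟨_, rfl⟩
  exact this hc

end Spans

/-! ### The lattices spanned by the Schur functions and by the compound basis -/

section Lattices

open MvPolynomial

lemma altSquare_h_mem_monSpan (m : ℕ) : altSquare h m ∈ monSpan hTwo m := by
  rw [altSquare_h, cauchy]
  refine Submodule.sum_mem _ fun i hi => ?_
  have hi : i ≤ m := by simpa [Nat.lt_succ_iff] using hi
  have := mul_mem_monSpan (mem_monSpan hTwo i) (mem_monSpan hTwo (m - i))
  rwa [Nat.add_sub_cancel' hi] at this

lemma altSquare_mem_monSpan {R : Type*} [CommRing R] (u : ℕ → R) (m : ℕ) :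
    altSquare u m ∈ monSpan u (2 * m) := by
  rw [altSquare]
  refine Submodule.sum_mem _ fun i hi => ?_
  have hi : i ≤ 2 * m := by simpa [Nat.lt_succ_iff] using hi
  have := mul_mem_monSpan (mem_monSpan u i) (mem_monSpan u (2 * m - i))
  rw [Nat.add_sub_cancel' hi] at this
  have := Submodule.smul_mem _ ((-1 : ℤ) ^ i) this
  simpa [zsmul_eq_mul] using this

lemma altSquare_h_zero : altSquare h 0 = 1 := by simp [altSquare, h_zero]

lemma h_mem_biSpan (n : ℕ) : h n ∈ biSpan q hTwo n := by
  rw [h_eq_sum]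
  refine Submodule.sum_mem _ fun i hi => ?_
  have hi : i < n / 2 + 1 := by simpa using hi
  have := mul_mem_biSpan (left_mem_biSpan q hTwo (n - 2 * i)) (right_mem_biSpan q hTwo i)
  rwa [show n - 2 * i + 2 * i = n by omega] at this

/-- Since h'_0 = 1, the relation h(z) = q(z)h'(z²) can be solved for q_n without denominators. -/
lemma q_mem_biSpan (n : ℕ) : q n ∈ biSpan h hTwo n := by
  induction n using Nat.strong_induction_on with
  | _ n ih =>
    have h1 := h_eq_sum n
    rw [Finset.sum_range_succ', hTwo_zero, mul_one, mul_zero, Nat.sub_zero] at h1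
    rw [← sub_eq_iff_eq_add'.2 h1]
    refine sub_mem (left_mem_biSpan h hTwo n) (Submodule.sum_mem _ fun i hi => ?_)
    have hi : i < n / 2 := by simpa using hi
    have := mul_mem_biSpan (ih (n - 2 * (i + 1)) (by omega)) (right_mem_biSpan h hTwo (i + 1))
    rwa [show n - 2 * (i + 1) + 2 * (i + 1) = n by omega] at this

lemma schurS_mem_monSpan (α : Multiset ℕ) : schurS α ∈ monSpan h α.sum :=
  (hasLeading_schurS α).mem_monSpan

lemma schurQ_mem_monSpan (α : Multiset ℕ) : schurQ α ∈ monSpan q α.sum :=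
  (hasLeading_schurQ α).mem_monSpan

lemma rename_monOf_h (β : Multiset ℕ) : rename (fun j => 2 * j) (monOf h β) = monOf hTwo β := by
  rw [monOf, map_multiset_prod, Multiset.map_map]
  rfl

/-- The substitution `t_j ↦ t_{2j}` as a `ℤ`-linear map. -/
def renameTwo : V →ₗ[ℤ] V := (rename (fun j => 2 * j) : V →ₐ[ℚ] V).toLinearMap.restrictScalars ℤ

lemma renameTwo_mem_monSpan {s : ℕ} {x : V} (hx : x ∈ monSpan h s) :
    renameTwo x ∈ monSpan hTwo s := by
  have : monSpan h s ≤ (monSpan hTwo s).comap renameTwo := by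
    apply Submodule.span_le.2
    rintro _ ⟨β, hβ, rfl⟩
    show rename (fun j => 2 * j) (monOf h β) ∈ monSpan hTwo s
    rw [rename_monOf_h]
    exact monOf_mem_monSpan hTwo hβ
  exact this hx

lemma compoundW_mem_span {n : ℕ} (ρ : n.Partition) : compoundW ρ.parts ∈
    Submodule.span ℤ (Set.range fun ρ : n.Partition => rdProd h hTwo ρ) := by
  apply biSpan_le_span_rdProd h_zero hTwo_zero altSquare_h_mem_monSpan
  apply biSpan_le q_mem_biSpan
  exact mul_mem_biSpan_of_monSpan (schurQ_mem_monSpan _)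
    (renameTwo_mem_monSpan (schurS_mem_monSpan _)) (by rw [sum_rPart_add, ρ.parts_sum])

lemma rdProd_mem_span_compoundW {n : ℕ} (ρ : n.Partition) : rdProd h hTwo ρ ∈
    Submodule.span ℤ (Set.range fun ρ : n.Partition => compoundW ρ.parts) := by
  set B := Submodule.span ℤ (Set.range fun ρ : n.Partition => compoundW ρ.parts)
  have key : biSpan q hTwo n ≤ B := by
    apply Submodule.span_le.2
    rintro _ ⟨α, β, hn, rfl⟩
    -- One factor is frozen while the other is expanded, first in Q-functions, then in Schur
    -- functions of t'.
    suffices monOf q α ∈ B.comap (LinearMap.mulRight ℤ (monOf hTwo β)) from this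
    refine monOf_q_mem_of_schurQ (fun σ hσ => ?_) rfl
    show schurQ σ.parts * monOf hTwo β ∈ B
    rw [← rename_monOf_h]
    suffices monOf h β ∈ B.comap ((LinearMap.mulLeft ℤ (schurQ σ.parts)).comp renameTwo) from this
    refine monOf_h_mem_of_schurS (fun τ => ?_) rfl
    show schurQ σ.parts * rename (fun j => 2 * j) (schurS τ.parts) ∈ B
    refine Submodule.subset_span ⟨joinPartition σ.parts τ.parts (zero_notMem_of_le σ le_rfl)
      (zero_notMem_of_le τ le_rfl) (by rw [σ.parts_sum, τ.parts_sum, hn]), ?_⟩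
    simp only [joinPartition, compoundW]
    rw [rPart_add_two_nsmul hσ, dPart_add_two_nsmul hσ]
  exact key (biSpan_le h_mem_biSpan n (rdProd_mem_biSpan h hTwo ρ))

lemma schurS_mem_span {n : ℕ} (ρ : n.Partition) : schurS ρ.parts ∈
    Submodule.span ℤ (Set.range fun ρ : n.Partition => rdProd h (altSquare h) ρ) := by
  -- With v = `altSquare h` the absorption hypothesis is a tautology.
  apply biSpan_le_span_rdProd h_zero altSquare_h_zero (mem_monSpan _)
  rw [← mul_one (schurS ρ.parts)]
  exact mul_mem_biSpan_of_monSpan (schurS_mem_monSpan _) (one_mem_monSpan _)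
    (by simp [ρ.parts_sum])

lemma rdProd_mem_span_schurS {n : ℕ} (ρ : n.Partition) : rdProd h (altSquare h) ρ ∈
    Submodule.span ℤ (Set.range fun ρ : n.Partition => schurS ρ.parts) := by
  have h1 := monOf_mem_graded (one_mem_monSpan h) (fun _ _ _ _ hx hy => mul_mem_monSpan hx hy)
    (u := altSquare h) 2 (α := dPart ρ.parts) (fun a _ => altSquare_mem_monSpan h a)
  have h2 := mul_mem_monSpan (monOf_mem_monSpan h (rfl : (rPart ρ.parts).sum = _)) h1
  rw [sum_rPart_add, ρ.parts_sum] at h2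
  refine (Submodule.span_le (p := Submodule.span ℤ _)).2 ?_ h2
  rintro _ ⟨β, hβ, rfl⟩
  exact monOf_h_mem_of_schurS (fun σ => Submodule.subset_span (Set.mem_range_self σ)) hβ

lemma linearIndependent_monOf_X (n : ℕ) :
    LinearIndependent ℚ fun ρ : n.Partition => (monOf X ρ.parts : V) := by
  have h1 : ∀ α : Multiset ℕ, (monOf X α : V) = monomial (Multiset.toFinsupp α) 1 := by
    intro α
    induction α using Multiset.induction_on with
    | empty => simp
    | cons a α ih =>
      rw [monOf_cons, ih, ← Multiset.singleton_add, map_add, Multiset.toFinsupp_singleton,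
        X, monomial_mul, one_mul]
  have h2 := (basisMonomials ℕ ℚ).linearIndependent.comp
    (fun ρ : n.Partition => Multiset.toFinsupp ρ.parts)
    (fun ρ σ hρ => Nat.Partition.ext (Multiset.toFinsupp.injective hρ))
  simpa [Function.comp_def, h1] using h2

/-- Newton's recursion is solved for t_n; the division by n is why the span is rational here. -/
lemma X_mem_span_monOf_h {n : ℕ} (hn : n ≠ 0) :
    (X n : V) ∈ Submodule.span ℚ {x | ∃ ν : Multiset ℕ, ν.sum = n ∧ monOf h ν = x} := by
  induction n using Nat.strong_induction_on with
  | _ n ih =>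
    obtain ⟨n, rfl⟩ := Nat.exists_eq_succ_of_ne_zero hn
    have h1 := succ_mul_h n
    rw [Finset.sum_range_succ, Nat.sub_self, h_zero, mul_one] at h1
    have h0 : ((n + 1 : ℕ) : ℚ) ≠ 0 := by exact_mod_cast hn
    have h2 : (X (n + 1) : V) = h (n + 1) - ((n + 1 : ℕ) : ℚ)⁻¹ •
        ∑ i ∈ Finset.range n, ((i + 1 : ℕ) : ℚ) • (X (i + 1) * h (n - i)) := by
      have h3 : ∀ (k : ℕ) (x : V), (k : ℚ) • x = (k : V) * x := fun k x => by
        rw [Nat.cast_smul_eq_nsmul, nsmul_eq_mul]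
      apply (smul_right_injective V h0)
      simp only [smul_sub, smul_inv_smul₀ h0]
      simp only [h3, ← mul_assoc]
      linear_combination -h1
    rw [Nat.succ_eq_add_one, h2]
    refine sub_mem (Submodule.subset_span ⟨{n + 1}, by simp⟩)
      (Submodule.smul_mem _ _ (Submodule.sum_mem _ fun i hi => Submodule.smul_mem _ _ ?_))
    have hi : i < n := by simpa using hi
    refine mul_mem_span_of_forall ?_ (ih (i + 1) (by omega) (by omega))
      (Submodule.subset_span (s := {h (n - i)}) rfl)
    rintro _ ⟨α, hα, rfl⟩ _ rfl
    exact ⟨α + {n - i}, by simp [hα]; omega, by simp [monOf_add]⟩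

lemma linearIndependent_schurS (n : ℕ) :
    LinearIndependent ℚ fun ρ : n.Partition => schurS ρ.parts := by
  refine linearIndependent_of_mem_span (linearIndependent_monOf_X n) fun ρ => ?_
  have h1 := monOf_mem_graded (S := ℚ) (R := V)
    (L := fun n => Submodule.span ℚ {x | ∃ ν : Multiset ℕ, ν.sum = n ∧ monOf h ν = x})
    (Submodule.subset_span ⟨0, by simp⟩) (fun i j x y hx hy => by
      refine mul_mem_span_of_forall ?_ hx hy
      rintro _ ⟨α, hα, rfl⟩ _ ⟨β, hβ, rfl⟩
      exact ⟨α + β, by simp [hα, hβ], monOf_add _ _ _⟩) (u := X) 1 (α := ρ.parts)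
    (fun a ha => by rw [one_mul]; exact X_mem_span_monOf_h (ρ.parts_pos ha).ne')
  rw [one_mul, ρ.parts_sum] at h1
  refine (Submodule.span_le (p := Submodule.span ℚ _)).2 ?_ h1
  rintro _ ⟨β, hβ, rfl⟩
  exact Submodule.span_subset_span ℤ ℚ _
    (monOf_h_mem_of_schurS (fun σ => Submodule.subset_span (Set.mem_range_self σ)) hβ)

/-- The end terms of ∑ h'_i h'_(m-i) give 2h'_m, the source of every power of 2. The weight is
negated because splitting m lowers the sum of squares. -/
lemma hasLeading_altSquare_h {m : ℕ} (hm : m ≠ 0) :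
    HasLeading hTwo (fun k => -sq k) 2 {m} (altSquare h m) := by
  obtain ⟨m, rfl⟩ := Nat.exists_eq_succ_of_ne_zero hm
  have h1 : altSquare h (m + 1) - (2 : ℤ) • monOf hTwo {m + 1} =
      ∑ i ∈ Finset.range m, monOf hTwo {i + 1, m - i} := by
    rw [altSquare_h, cauchy, Finset.sum_range_succ, Finset.sum_range_succ']
    simp only [Multiset.insert_eq_cons, monOf_cons, monOf_singleton, hTwo_zero, Nat.sub_self,
      Nat.sub_zero, Nat.add_sub_add_right, zsmul_eq_mul]
    push_cast
    ring
  rw [HasLeading, Nat.succ_eq_add_one, h1]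
  refine Submodule.sum_mem _ fun i hi => monOf_mem_above _ ?_ ?_
  all_goals have hi : i < m := by simpa using hi
  · simp [Multiset.insert_eq_cons]; omega
  · simp only [Multiset.insert_eq_cons, Multiset.map_cons, Multiset.map_singleton,
      Multiset.sum_cons, Multiset.sum_singleton, sq]
    have h2 : ((m - i : ℕ) : ℤ) = m - i := by omega
    have h3 : (i : ℤ) < m := by exact_mod_cast hi
    rw [h2]
    push_cast
    nlinarith [Int.natCast_nonneg i, mul_pos (sub_pos.2 h3) (by positivity : (0 : ℤ) < i + 1)]

lemma hasLeading_monOf_altSquare_h {β : Multiset ℕ} (hβ : 0 ∉ β) :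
    HasLeading hTwo (fun k => -sq k) (2 ^ β.card) β (monOf (altSquare h) β) := by
  induction β using Multiset.induction_on with
  | empty => simpa using hasLeading_monOf hTwo (fun k => -sq k) 0
  | cons a β ih =>
    simp only [Multiset.mem_cons, not_or] at hβ
    have := (hasLeading_altSquare_h (Ne.symm hβ.1)).mul (ih hβ.2)
    rwa [Multiset.singleton_add, ← monOf_cons, ← pow_succ', ← Multiset.card_cons] at this

lemma rdProd_sub_mem {n : ℕ} (ρ : n.Partition) :
    rdProd h (altSquare h) ρ - (2 ^ (dPart ρ.parts).card : ℤ) • rdProd h hTwo ρ ∈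
      Submodule.span ℤ ((fun ρ : n.Partition => rdProd h hTwo ρ) ''
        {σ | (σ.parts.map sq).sum < (ρ.parts.map sq).sum}) := by
  set B := Submodule.span ℤ ((fun ρ : n.Partition => rdProd h hTwo ρ) ''
        {σ | (σ.parts.map sq).sum < (ρ.parts.map sq).sum}) with hB
  have h1 := hasLeading_monOf_altSquare_h (zero_notMem_dPart ρ)
  rw [rdProd, rdProd, ← mul_smul_comm, ← mul_sub]
  suffices above hTwo (fun k => -sq k) (dPart ρ.parts).sum
      ((dPart ρ.parts).map fun k => -sq k).sum ≤
      B.comap (LinearMap.mulLeft ℤ (monOf h (rPart ρ.parts))) from this h1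
  apply Submodule.span_le.2
  rintro _ ⟨ν, hν, hw, rfl⟩
  show monOf h (rPart ρ.parts) * monOf hTwo ν ∈ B
  have hs : (ν.filter (· ≠ 0)).sum = ν.sum := sum_filter_ne_zero ν
  have hnd := nodup_rPart ρ.parts
  rw [← monOf_filter_ne_zero hTwo_zero, ← rdProd_joinPartition (n := n) h hTwo
    (zero_notMem_rPart ρ) (by simp) (by rw [hs, hν, sum_rPart_add, ρ.parts_sum]) hnd]
  refine Submodule.subset_span ⟨_, ?_, rfl⟩
  -- The weight of λ is that of λ^r plus twice that of λ^d, so with λ^r fixed a lighter second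
  -- factor gives a lighter partition.
  have h2 := sum_map_rPart_add sq ρ.parts
  have h3 := sum_map_filter_ne_zero sq_zero ν
  simp only [Multiset.sum_map_neg] at hw
  simp only [Set.mem_ofPred_eq, joinPartition, Multiset.map_add, Multiset.sum_add,
    two_nsmul] at h2 ⊢
  rw [h3]
  linarith

end Lattices

end

end CompoundBasis

theorem mainTheorem1 (n : ℕ) :
    LinearIndependent ℚ (fun μ : n.Partition => CompoundBasis.compoundW μ.parts) ∧
    ∃ A : Matrix n.Partition n.Partition ℤ,
      (∀ lam : n.Partition, CompoundBasis.schurS lam.parts =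
        ∑ μ : n.Partition, (A lam μ : ℚ) • CompoundBasis.compoundW μ.parts) ∧
      |A.det| = 2 ^ (∑ lam : n.Partition, (CompoundBasis.dPart lam.parts).card) ∧
      ((∑ lam : n.Partition, (CompoundBasis.dPart lam.parts).card : ℕ) : ℤ) =
        ∑ lam : n.Partition,
          (((CompoundBasis.glaisher (CompoundBasis.rPart lam.parts)).card : ℤ) -
            ((CompoundBasis.rPart lam.parts).card : ℤ)) := by
  -- Independence passes from the Schur functions through both product families to the W_μ, each
  -- family lying in the integral span of the next.
  open CompoundBasis in
  have hG : LinearIndependent ℚ fun ρ : n.Partition => rdProd h (altSquare h) ρ :=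
    linearIndependent_of_mem_int_span (linearIndependent_schurS n) schurS_mem_span
  obtain ⟨U, hU, hUdet⟩ := exists_unimodular_matrix hG schurS_mem_span rdProd_mem_span_schurS
  obtain ⟨D, hD, hDdet⟩ := exists_triangular_matrix
    (fun ρ : n.Partition => (ρ.parts.map sq).sum) _ rdProd_sub_mem
  have hH : LinearIndependent ℚ fun ρ : n.Partition => rdProd h hTwo ρ :=
    linearIndependent_of_mem_int_span hG fun ρ =>
      (Submodule.mem_span_range_iff_exists_fun ℤ).2 ⟨D ρ, (hD ρ).symm⟩
  have hW : LinearIndependent ℚ fun ρ : n.Partition => compoundW ρ.parts :=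
    linearIndependent_of_mem_int_span hH rdProd_mem_span_compoundW
  obtain ⟨T, hT, hTdet⟩ := exists_unimodular_matrix hW rdProd_mem_span_compoundW compoundW_mem_span
  refine ⟨hW, U * D * T, fun ρ => ?_, ?_, sum_card_dPart n⟩
  · simp only [Int.cast_smul_eq_zsmul]
    exact eq_sum_matrix_mul (eq_sum_matrix_mul hU hD) hT ρ
  · rw [Matrix.det_mul, Matrix.det_mul, abs_mul, abs_mul, hUdet, hTdet, one_mul, mul_one, hDdet,
      Finset.prod_pow_eq_pow_sum, abs_of_pos (by positivity)]
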